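/- Let $k$ be an algebraically closed field of characteristic $0$, let $X$ be a smooth affine variety over $k$ with coordinate ring $\mathcal O=\mathcal O_X(X)$ (a smooth finitely generated commutative $k$-algebra), and let $\mathcal D\subset \mathrm{End}_k(\mathcal O)$ be the ring of differential operators: $\mathcal D=\bigcup_i F_i$ with $F_{-1}=0$ and $F_i=\{P : [P,a]\in F_{i-1}\text{ for all }a\in\mathcal O\}$. Let $\mathtt{DG}\mathcal D\mathtt M$ be the category of non-negatively graded chain complexes of left $\mathcal D$-modules. For $\mathcal D$-modules $M,N$, the module $M\otimes_{\mathcal O}N$ is a $\mathcal D$-module, on which vector fields $\theta$ act by $\theta(m\otimes n)=\theta m\otimes n+m\otimes\theta n$. Equip $\mathtt{DG}\mathcal D\mathtt M$ with the resulting tensor product of complexes, $(K\otimes L)_n=\bigoplus_{p+q=n}K_p\otimes_{\mathcal O}L_q$, $d(x\otimes y)=dx\otimes y+(-1)^{p}x\otimes dy$ for $x\in K_p$, with unit $\mathcal O$ concentrated in degree $0$ and symmetry $x\otimes y\mapsto(-1)^{pq}y\otimes x$ for $x\in K_p$, $y\in L_q$. Then the following hold. 1. $\mathtt{DG}\mathcal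 D\mathtt M$ has all small limits and colimits and is a model category, with functorial factorizations, in which the weak equivalences are the quasi-isomorphisms, the fibrations are the chain maps that are surjective in all positive degrees, and the cofibrations are the injective chain maps whose cokernel is, in each degree, a projective $\mathcal D$-module. 2. The symmetric monoidal structure is closed, and with the model structure of 1. it makes $\mathtt{DG}\mathcal D\mathtt M$ a symmetric monoidal model category, i.e.: (MMC1) for any two cofibrations $f:T\to U$ and $g:V\to W$ the pushout product $f\,\Box\, g: (U\otimes V)\amalg_{T\otimes V}(T\otimes W)\to U\otimes W$ is a cofibration, and it is a weak equivalence if $f$ or $g$ is one; (MMC2) if $Q\to\mathcal O$ is a trivial fibration $q$ with $Q$ cofibrant, then $q\otimes\mathrm{id}_C:Q\otimes C\to\mathcal O\otimes C$ is a weak equivalence for every cofibrant $C$. 3. If $f$ is a quasi-isomorphism and $M$ is cofibrant, then $f\otimes\mathrm{id}_M$ is a quasi-isomorphism. -/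

import Mathlib

universe w v u

noncomputable section

namespace DMod

open CategoryTheory Limits MonoidalCategory TensorProduct

section Operators

variable (k : Type v) (O : Type u) [Field k] [CommRing O] [Algebra k O]

/-- The `k`-linear operator of multiplication by `a` on `O`. -/
def mulOp (a : O) : Module.End k O := Algebra.lmul k O a

@[simp]
theorem mulOp_apply (a f : O) : mulOp k O a f = a * f := rfl

/-- `orderLT k O n` is the `O`-module of `k`-linear differential operators on `O` of order `< n`
(that is, of order `≤ n - 1`): only the zero operator has order `< 0`, and `P` has order `< n + 1`
iff all the commutators `[P, a]` with `a ∈ O` have order `< n`. -/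
def orderLT : ℕ → Submodule O (Module.End k O)
  | 0 => ⊥
  | n + 1 =>
    { carrier := {P | ∀ a : O, P * mulOp k O a - mulOp k O a * P ∈ orderLT n}
      zero_mem' := fun a => by simp
      add_mem' := fun {P Q} hP hQ a => by
        have : (P + Q) * mulOp k O a - mulOp k O a * (P + Q) =
          (P * mulOp k O a - mulOp k O a * P) + (Q * mulOp k O a - mulOp k O a * Q) := by
          noncomm_ring
        rw [this]
        exact add_mem (hP a) (hQ a)
      smul_mem' := fun c P hP a => by
        have : (c • P) * mulOp k O a - mulOp k O a * (c • P) =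
          c • (P * mulOp k O a - mulOp k O a * P) := by
          ext f
          simp
          ring_nf
        rw [this]
        exact Submodule.smul_mem _ _ (hP a) }

variable {k O}

theorem mem_orderLT_succ {n : ℕ} {P : Module.End k O} :
    P ∈ orderLT k O (n + 1) ↔ ∀ a : O, P * mulOp k O a - mulOp k O a * P ∈ orderLT k O n :=
  Iff.rfl

theorem mulOp_mul (a : O) (P : Module.End k O) : mulOp k O a * P = a • P := by
  ext f; simp

theorem orderLT_le_succ (n : ℕ) : orderLT k O n ≤ orderLT k O (n + 1) := by
  induction n with
  | zero => exact bot_le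
  | succ n ih => exact fun P hP a => ih (hP a)

theorem orderLT_mono : Monotone (orderLT k O) := monotone_nat_of_le_succ orderLT_le_succ

theorem mul_mem_orderLT (m n : ℕ) {P Q : Module.End k O} (hP : P ∈ orderLT k O (m + 1))
    (hQ : Q ∈ orderLT k O (n + 1)) : P * Q ∈ orderLT k O (m + n + 1) := by
  suffices H : ∀ (N m n : ℕ), m + n = N → ∀ P ∈ orderLT k O m, ∀ Q ∈ orderLT k O n,
      P * Q ∈ orderLT k O (m + n - 1) by
    have := H _ (m + 1) (n + 1) rfl P hP Q hQ
    rwa [show m + 1 + (n + 1) - 1 = m + n + 1 by omega] at this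
  intro N
  induction N with
  | zero =>
    intro m n h P hP Q hQ
    obtain rfl : m = 0 := by omega
    obtain rfl : P = 0 := by simpa [orderLT] using hP
    simp
  | succ N ih =>
    intro m n h P hP Q hQ
    rcases m with _ | m
    · obtain rfl : P = 0 := by simpa [orderLT] using hP
      simp
    rcases n with _ | n
    · obtain rfl : Q = 0 := by simpa [orderLT] using hQ
      simp
    rw [show m + 1 + (n + 1) - 1 = m + n + 1 by omega]
    intro a
    have e : P * Q * mulOp k O a - mulOp k O a * (P * Q) =
        P * (Q * mulOp k O a - mulOp k O a * Q) + (P * mulOp k O a - mulOp k O a * P) * Q := by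
      simp only [mul_sub, sub_mul, mul_assoc]
      abel
    rw [e]
    refine add_mem ?_ ?_
    · have := ih (m + 1) n (by omega) P hP _ (hQ a)
      rwa [show m + 1 + n - 1 = m + n by omega] at this
    · have := ih m (n + 1) (by omega) _ (hP a) Q hQ
      rwa [show m + (n + 1) - 1 = m + n by omega] at this

theorem mulOp_mem_orderLT (a : O) : mulOp k O a ∈ orderLT k O 1 := by
  intro b
  have : mulOp k O a * mulOp k O b - mulOp k O b * mulOp k O a = 0 := by
    ext f; simp; ring
  rw [this]
  exact zero_mem _

theorem derivation_mem_orderLT (θ : Derivation k O O) :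
    (θ : O →ₗ[k] O) ∈ orderLT k O 2 := by
  intro a
  have : (θ : Module.End k O) * mulOp k O a - mulOp k O a * (θ : O →ₗ[k] O) = mulOp k O (θ a) := by
    ext f; simp; ring
  rw [this]
  exact mulOp_mem_orderLT _

variable (k O)

/-- The ring `D` of `k`-linear differential operators (of all finite orders) on `O`. -/
def DiffOp : Subring (Module.End k O) where
  carrier := {P | ∃ n, P ∈ orderLT k O n}
  mul_mem' := by
    rintro P Q ⟨m, hP⟩ ⟨n, hQ⟩
    exact ⟨_, mul_mem_orderLT m n (orderLT_le_succ _ hP) (orderLT_le_succ _ hQ)⟩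
  one_mem' := ⟨1, by
    have : (1 : Module.End k O) = mulOp k O 1 := by ext; simp
    rw [this]
    exact mulOp_mem_orderLT 1⟩
  add_mem' := by
    rintro P Q ⟨m, hP⟩ ⟨n, hQ⟩
    exact ⟨max m n, add_mem (orderLT_mono (le_max_left _ _) hP)
      (orderLT_mono (le_max_right _ _) hQ)⟩
  zero_mem' := ⟨0, zero_mem _⟩
  neg_mem' := by
    rintro P ⟨n, hP⟩
    exact ⟨n, neg_mem hP⟩

/-- The inclusion `O → D` of functions as multiplication operators. -/
def ofFun : O →+* DiffOp k O where
  toFun a := ⟨mulOp k O a, 1, mulOp_mem_orderLT a⟩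
  map_one' := by ext; simp
  map_mul' a b := by ext; simp [mul_assoc]
  map_zero' := by ext; simp
  map_add' a b := by ext; simp [add_mul]

variable {k O} in
/-- The inclusion of vector fields in `D`. -/
def ofDer (θ : Derivation k O O) : DiffOp k O := ⟨(θ : O →ₗ[k] O), 2, derivation_mem_orderLT θ⟩

end Operators

section Coordinates

variable (k : Type v) (O : Type u) [Field k] [CommRing O] [Algebra k O]

/-- A finite dual basis for the module of differentials: functions `x i` and vector fields `∂ i`
with `da = ∑ i, ∂ i (a) • d(x i)`. -/
theorem exists_coords [Algebra.Smooth k O] :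
    ∃ (S : Finset O) (p : O → Derivation k O O), ∀ a : O,
      KaehlerDifferential.D k O a = ∑ x ∈ S, p x a • KaehlerDifferential.D k O x := by
  classical
  have hsurj : Function.Surjective
      (Finsupp.linearCombination O (fun x : O => KaehlerDifferential.D k O x)) := by
    rw [← LinearMap.range_eq_top, Finsupp.range_linearCombination]
    exact KaehlerDifferential.span_range_derivation k O
  obtain ⟨s, hs⟩ := Module.projective_lifting_property _
    (LinearMap.id : Ω[O⁄k] →ₗ[O] Ω[O⁄k]) hsurj
  obtain ⟨T, hT⟩ := (Module.Finite.fg_top : (⊤ : Submodule O Ω[O⁄k]).FG)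
  refine ⟨T.biUnion fun g => (s g).support,
    fun x => ((Finsupp.lapply x).comp s).compDer (KaehlerDifferential.D k O), fun a => ?_⟩
  have hsupp : ∀ w, s w ∈ Finsupp.supported O O
      (↑(T.biUnion fun g => (s g).support) : Set O) := by
    intro w
    have hw : w ∈ Submodule.span O (T : Set Ω[O⁄k]) := hT ▸ Submodule.mem_top
    have : Submodule.span O (T : Set Ω[O⁄k]) ≤ (Finsupp.supported O O
      (↑(T.biUnion fun g => (s g).support) : Set O)).comap s := by
      rw [Submodule.span_le]
      intro g hg
      simp only [Submodule.comap_coe, Set.mem_preimage, SetLike.mem_coe]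
      rw [Finsupp.mem_supported]
      intro x hx
      simp only [Finset.coe_biUnion, Set.mem_iUnion]
      exact ⟨g, hg, hx⟩
    exact this hw
  have h1 := LinearMap.congr_fun hs (KaehlerDifferential.D k O a)
  simp only [LinearMap.comp_apply, LinearMap.id_apply] at h1
  rw [Finsupp.linearCombination_apply, Finsupp.sum_of_support_subset _
    (s := T.biUnion fun g => (s g).support)] at h1
  · exact h1.symm
  · have := hsupp (KaehlerDifferential.D k O a)
    rw [Finsupp.mem_supported] at this
    exact_mod_cast this
  · simp

variable {k O}

theorem derivation_eq_sum {S : Finset O} {p : O → Derivation k O O}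
    (h : ∀ a : O, KaehlerDifferential.D k O a = ∑ x ∈ S, p x a • KaehlerDifferential.D k O x)
    {M : Type*} [AddCommGroup M] [Module k M] [Module O M] [IsScalarTower k O M]
    (δ : Derivation k O M) (a : O) : δ a = ∑ x ∈ S, p x a • δ x := by
  have := congrArg δ.liftKaehlerDifferential (h a)
  simpa using this

/-- The Euler identity in the order filtration: the symbol of order `n` is homogeneous. -/
theorem euler_orderLT {S : Finset O} {p : O → Derivation k O O}
    (h : ∀ a : O, KaehlerDifferential.D k O a = ∑ x ∈ S, p x a • KaehlerDifferential.D k O x)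
    (n : ℕ) : ∀ P ∈ orderLT k O (n + 1),
      (∑ x ∈ S, (P * mulOp k O x - mulOp k O x * P) * (p x : O →ₗ[k] O)) - n • P ∈
        orderLT k O n := by
  induction n with
  | zero =>
    intro P hP
    have : ∀ a, P * mulOp k O a - mulOp k O a * P = 0 := fun a => by simpa [orderLT] using hP a
    simp [this]
  | succ n ih =>
    intro P hP a
    -- the map `f ↦ [P, f]` is a derivation modulo operators of lower order
    let δ : Derivation k O (Module.End k O ⧸ orderLT k O n) :=
      Derivation.mk'
        { toFun := fun f => Submodule.Quotient.mk (P * mulOp k O f - mulOp k O f * P)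
          map_add' := fun f g => by
            rw [← Submodule.Quotient.mk_add]
            congr 1
            ext t
            simp [add_mul]
            ring
          map_smul' := fun c f => by
            rw [RingHom.id_apply, ← algebraMap_smul O c, ← Submodule.Quotient.mk_smul]
            congr 1
            ext t
            simp only [LinearMap.sub_apply, Module.End.mul_apply, mulOp_apply,
              LinearMap.smul_apply, smul_mul_assoc, map_smul, algebraMap_smul, smul_sub] }
        (fun f g => by
          simp only [LinearMap.coe_mk, AddHom.coe_mk]
          rw [← Submodule.Quotient.mk_smul, ← Submodule.Quotient.mk_smul,
            ← Submodule.Quotient.mk_add, Submodule.Quotient.eq]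
          have hc := hP f g
          convert hc using 1
          ext t
          simp [mul_sub]
          ring_nf)
    have hδ := derivation_eq_sum h δ a
    have hmem : (P * mulOp k O a - mulOp k O a * P) -
        ∑ x ∈ S, p x a • (P * mulOp k O x - mulOp k O x * P) ∈ orderLT k O n := by
      rw [← Submodule.Quotient.eq]
      have e : (Submodule.Quotient.mk (∑ x ∈ S, p x a • (P * mulOp k O x - mulOp k O x * P)) :
          Module.End k O ⧸ orderLT k O n) = ∑ x ∈ S, p x a • δ x := by
        rw [← Submodule.mkQ_apply, map_sum]
        rfl
      rw [e, ← hδ]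
      rfl
    have hcomm : ∑ x ∈ S, ((P * mulOp k O x - mulOp k O x * P) * mulOp k O (p x a) -
        p x a • (P * mulOp k O x - mulOp k O x * P)) ∈ orderLT k O n := by
      refine Submodule.sum_mem _ fun x _ => ?_
      have := hP x (p x a)
      rwa [mulOp_mul] at this
    have hI := ih _ (hP a)
    have key : ((∑ x ∈ S, (P * mulOp k O x - mulOp k O x * P) * (p x : O →ₗ[k] O)) -
          (n + 1) • P) * mulOp k O a - mulOp k O a *
          ((∑ x ∈ S, (P * mulOp k O x - mulOp k O x * P) * (p x : O →ₗ[k] O)) - (n + 1) • P) =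
        ((∑ x ∈ S, ((P * mulOp k O a - mulOp k O a * P) * mulOp k O x -
            mulOp k O x * (P * mulOp k O a - mulOp k O a * P)) * (p x : O →ₗ[k] O)) -
          n • (P * mulOp k O a - mulOp k O a * P)) +
        (∑ x ∈ S, ((P * mulOp k O x - mulOp k O x * P) * mulOp k O (p x a) -
          p x a • (P * mulOp k O x - mulOp k O x * P))) -
        ((P * mulOp k O a - mulOp k O a * P) -
          ∑ x ∈ S, p x a • (P * mulOp k O x - mulOp k O x * P)) := by
      have e : ∀ x, (P * mulOp k O x - mulOp k O x * P) * (p x : O →ₗ[k] O) * mulOp k O a -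
          mulOp k O a * ((P * mulOp k O x - mulOp k O x * P) * (p x : O →ₗ[k] O)) =
          ((P * mulOp k O a - mulOp k O a * P) * mulOp k O x -
            mulOp k O x * (P * mulOp k O a - mulOp k O a * P)) * (p x : O →ₗ[k] O) +
          (P * mulOp k O x - mulOp k O x * P) * mulOp k O (p x a) := by
        intro x
        ext t
        simp [mul_add, mul_sub, mul_comm, mul_left_comm]
        ring_nf
      have e2 := Finset.sum_congr (rfl : S = S) fun x _ => e x
      rw [Finset.sum_add_distrib, Finset.sum_sub_distrib, ← Finset.sum_mul, ← Finset.mul_sum] at e2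
      rw [Finset.sum_sub_distrib, sub_mul, mul_sub, smul_mul_assoc, mul_smul_comm, add_smul,
        add_smul, one_smul, one_smul, smul_sub]
      rw [← sub_eq_zero] at e2 ⊢
      refine Eq.trans ?_ e2
      abel
    rw [key]
    exact sub_mem (add_mem hI hcomm) hmem

end Coordinates

section Extension

variable (k : Type v) (O : Type u) [Field k] [CommRing O] [Algebra k O]

variable {k O} in
theorem ofDer_mul_ofFun (θ : Derivation k O O) (a : O) :
    ofDer θ * ofFun k O a = ofFun k O a * ofDer θ + ofFun k O (θ a) := by
  ext t
  simp [ofDer, ofFun, mul_comm]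

variable {k O} in
theorem ofDer_add (θ η : Derivation k O O) : ofDer (θ + η) = ofDer θ + ofDer η := by
  ext t
  simp [ofDer]

variable {k O} in
theorem ofDer_smul (a : O) (θ : Derivation k O O) :
    ofDer (a • θ) = ofFun k O a * ofDer θ := by
  ext t
  simp [ofDer, ofFun]

variable {k O} in
theorem ofDer_lie (θ η : Derivation k O O) :
    ofDer ⁅θ, η⁆ = ofDer θ * ofDer η - ofDer η * ofDer θ := by
  refine Subtype.ext (LinearMap.ext fun t => ?_)
  exact Derivation.commutator_apply t

/-- On a smooth `O` in characteristic zero, differential operators are generated by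
functions and vector fields. -/
theorem diffOp_induction [CharZero k] [Algebra.Smooth k O] {motive : DiffOp k O → Prop}
    (hf : ∀ a, motive (ofFun k O a)) (hd : ∀ θ, motive (ofDer θ))
    (hadd : ∀ P Q, motive P → motive Q → motive (P + Q))
    (hmul : ∀ P Q, motive P → motive Q → motive (P * Q)) (P : DiffOp k O) : motive P := by
  obtain ⟨S, p, h⟩ := exists_coords k O
  have hsum : ∀ (T : Finset O) (F : O → DiffOp k O), (∀ x, motive (F x)) →
      motive (∑ x ∈ T, F x) := by
    classical
    intro T F hF
    induction T using Finset.induction_on with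
    | empty => simpa using hf 0
    | insert a T ha ih => rw [Finset.sum_insert ha]; exact hadd _ _ (hF a) ih
  have hneg : ∀ P, motive P → motive (-P) := fun P hP => by
    have e : -P = ofFun k O (-1) * P := by
      ext t
      simp [ofFun]
    rw [e]
    exact hmul _ _ (hf (-1)) hP
  suffices H : ∀ (n : ℕ) (P : DiffOp k O), (P : Module.End k O) ∈ orderLT k O n → motive P by
    obtain ⟨n, hn⟩ := P.2
    exact H n P hn
  intro n
  induction n with
  | zero =>
    intro P hP
    obtain rfl : P = 0 := Subtype.ext (by simpa [orderLT] using hP)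
    simpa using hf 0
  | succ n ih =>
    intro P hP
    have hE := euler_orderLT h n _ hP
    set C : O → DiffOp k O := fun x => P * ofFun k O x - ofFun k O x * P with hC
    have hE' : (((∑ x ∈ S, C x * ofDer (p x)) - n • P : DiffOp k O) : Module.End k O) ∈
        orderLT k O n := by
      simpa [hC, ofDer, ofFun] using hE
    have h1 : motive (∑ x ∈ S, C x * ofDer (p x)) :=
      hsum _ _ fun x => hmul _ _ (ih _ (hP x)) (hd _)
    have h2 : motive (n • P) := by
      have e : n • P = (∑ x ∈ S, C x * ofDer (p x)) +
          -((∑ x ∈ S, C x * ofDer (p x)) - n • P) := by abel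
      rw [e]
      exact hadd _ _ h1 (hneg _ (ih _ hE'))
    rcases Nat.eq_zero_or_pos n with rfl | hn
    · have hP0 : ∀ a, (P : Module.End k O) * mulOp k O a = mulOp k O a * P := fun a => by
        have := hP a
        simpa [orderLT, sub_eq_zero] using this
      have : P = ofFun k O ((P : Module.End k O) 1) := by
        ext a
        have := LinearMap.congr_fun (hP0 a) 1
        simp only [Module.End.mul_apply, mulOp_apply, mul_one] at this
        simp [ofFun, this, mul_comm]
      rw [this]
      exact hf _
    · have := hmul _ _ (hf (algebraMap k O (n : k)⁻¹)) h2
      have e : ofFun k O (algebraMap k O (n : k)⁻¹) * n • P = P := by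
        have hn' : (n : k) ≠ 0 := by exact_mod_cast hn.ne'
        rw [nsmul_eq_mul, ← mul_assoc, ← map_natCast (ofFun k O) n, ← map_mul,
          ← map_natCast (algebraMap k O) n, ← map_mul, inv_mul_cancel₀ hn', map_one, map_one,
          one_mul]
      rwa [e] at this

/-- A flat connection on an `O`-module `V`: an action of vector fields on `V` which is
`O`-linear in the vector field, satisfies the Leibniz rule and is compatible with brackets. -/
structure FlatConnection (V : Type w) [AddCommGroup V] [Module O V] where
  nabla : Derivation k O O → V →+ V
  nabla_add : ∀ θ η v, nabla (θ + η) v = nabla θ v + nabla η v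
  nabla_smul : ∀ (a : O) θ v, nabla (a • θ) v = a • nabla θ v
  leibniz : ∀ θ (a : O) v, nabla θ (a • v) = θ a • v + a • nabla θ v
  nabla_lie : ∀ θ η v, nabla ⁅θ, η⁆ v = nabla θ (nabla η v) - nabla η (nabla θ v)

namespace FlatConnection

variable {k O} {V : Type w} [AddCommGroup V] [Module O V] (c : FlatConnection k O V)

/-- Pairs of an operator on functions and an operator on `V`. -/
abbrev Pairs (k : Type v) (O : Type u) [Field k] [CommRing O] [Algebra k O]
    (V : Type w) [AddCommGroup V] [Module O V] :=
  Module.End k O × AddMonoid.End V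

variable (k V) in
/-- The pair given by multiplication by a function. -/
def pairFun : O →+* Pairs k O V :=
  ((DiffOp k O).subtype.comp (ofFun k O)).prod
    (Module.toAddMonoidEnd O V)

/-- The pair given by a vector field. -/
def pairDer (θ : Derivation k O O) : Pairs k O V := ((θ : O →ₗ[k] O), c.nabla θ)

theorem pairDer_mul_pairFun (θ : Derivation k O O) (a : O) :
    c.pairDer θ * pairFun k V a = pairFun k V a * c.pairDer θ + pairFun k V (θ a) := by
  refine Prod.ext ?_ ?_
  · exact congrArg Subtype.val (ofDer_mul_ofFun θ a)
  · ext v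
    refine (c.leibniz θ a v).trans ?_
    rw [add_comm]
    rfl

theorem pairDer_add (θ η : Derivation k O O) :
    c.pairDer (θ + η) = c.pairDer θ + c.pairDer η := by
  refine Prod.ext ?_ ?_
  · exact congrArg Subtype.val (ofDer_add θ η)
  · ext v
    exact c.nabla_add θ η v

theorem pairDer_smul (a : O) (θ : Derivation k O O) :
    c.pairDer (a • θ) = pairFun k V a * c.pairDer θ := by
  refine Prod.ext ?_ ?_
  · exact congrArg Subtype.val (ofDer_smul a θ)
  · ext v
    exact c.nabla_smul a θ v

theorem pairDer_lie (θ η : Derivation k O O) :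
    c.pairDer ⁅θ, η⁆ = c.pairDer θ * c.pairDer η - c.pairDer η * c.pairDer θ := by
  refine Prod.ext ?_ ?_
  · exact congrArg Subtype.val (ofDer_lie θ η)
  · ext v
    exact c.nabla_lie θ η v

theorem pairDer_sum (S : Finset O) (f : O → O) (p : O → Derivation k O O) :
    c.pairDer (∑ x ∈ S, f x • p x) = ∑ x ∈ S, pairFun k V (f x) * c.pairDer (p x) := by
  classical
  induction S using Finset.induction_on with
  | empty =>
    have := c.pairDer_smul 0 0
    simpa using this
  | insert a T ha ih => rw [Finset.sum_insert ha, Finset.sum_insert ha, pairDer_add,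
      pairDer_smul, ih]

/-- Pairs generated by functions and at most `n - 1` vector fields. -/
def filt : ℕ → AddSubgroup (Pairs k O V)
  | 0 => ⊥
  | n + 1 => AddSubgroup.closure
      (Set.range (pairFun k V) ∪ {t | ∃ s ∈ filt n, ∃ θ, t = s * c.pairDer θ})

theorem pairFun_mem (n : ℕ) (a : O) : pairFun k V a ∈ c.filt (n + 1) :=
  AddSubgroup.subset_closure (Or.inl ⟨a, rfl⟩)

theorem mul_pairDer_mem {n : ℕ} {s : Pairs k O V} (hs : s ∈ c.filt n) (θ : Derivation k O O) :
    s * c.pairDer θ ∈ c.filt (n + 1) :=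
  AddSubgroup.subset_closure (Or.inr ⟨s, hs, θ, rfl⟩)

theorem filt_succ_le {n : ℕ} {A : AddSubgroup (Pairs k O V)} (h1 : ∀ a, pairFun k V a ∈ A)
    (h2 : ∀ s ∈ c.filt n, ∀ θ, s * c.pairDer θ ∈ A) : c.filt (n + 1) ≤ A := by
  refine (AddSubgroup.closure_le A).2 ?_
  rintro _ (⟨a, rfl⟩ | ⟨s, hs, θ, rfl⟩)
  exacts [h1 a, h2 s hs θ]

theorem filt_le_succ (n : ℕ) : c.filt n ≤ c.filt (n + 1) := by
  induction n with
  | zero => exact bot_le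
  | succ n ih =>
    exact c.filt_succ_le (c.pairFun_mem _) fun s hs θ => c.mul_pairDer_mem (ih hs) θ

theorem filt_mono : Monotone c.filt := monotone_nat_of_le_succ c.filt_le_succ

theorem pairFun_mul_mem (b : O) (n : ℕ) : ∀ s ∈ c.filt n, pairFun k V b * s ∈ c.filt n := by
  induction n with
  | zero =>
    intro s hs
    obtain rfl : s = 0 := hs
    simp
  | succ n ih =>
    refine c.filt_succ_le (A := (c.filt (n + 1)).comap (AddMonoidHom.mulLeft (pairFun k V b)))
      (fun a => ?_) (fun s hs θ => ?_)
    · rw [AddSubgroup.mem_comap, AddMonoidHom.coe_mulLeft]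
      rw [← map_mul]
      exact c.pairFun_mem _ _
    · rw [AddSubgroup.mem_comap, AddMonoidHom.coe_mulLeft]
      rw [← mul_assoc]
      exact c.mul_pairDer_mem (ih s hs) θ

/-- The commutator with a function, as an additive map. -/
def comm (a : O) : Pairs k O V →+ Pairs k O V :=
  AddMonoidHom.mulRight (pairFun k V a) - AddMonoidHom.mulLeft (pairFun k V a)

theorem comm_apply (a : O) (s : Pairs k O V) :
    comm a s = s * pairFun k V a - pairFun k V a * s := rfl

theorem comm_mul_pairDer (a : O) (s : Pairs k O V) (θ : Derivation k O O) :
    comm a (s * c.pairDer θ) = s * pairFun k V (θ a) + comm a s * c.pairDer θ := by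
  simp only [comm_apply, mul_assoc, pairDer_mul_pairFun, mul_add, sub_mul]
  abel

theorem comm_pairFun (a b : O) : comm a (pairFun k V b) = 0 := by
  rw [comm_apply, ← map_mul, ← map_mul, mul_comm, sub_self]

theorem comm_mem (a : O) (n : ℕ) : ∀ s ∈ c.filt (n + 1), comm a s ∈ c.filt n := by
  induction n generalizing a with
  | zero =>
    refine c.filt_succ_le (A := (c.filt 0).comap (comm a)) (fun b => ?_) (fun s hs θ => ?_)
    · rw [AddSubgroup.mem_comap]
      rw [comm_pairFun]
      exact zero_mem _
    · obtain rfl : s = 0 := hs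
      simp
  | succ n ih =>
    refine c.filt_succ_le (A := (c.filt (n + 1)).comap (comm a)) (fun b => ?_) (fun s hs θ => ?_)
    · rw [AddSubgroup.mem_comap]
      rw [comm_pairFun]
      exact zero_mem _
    · rw [AddSubgroup.mem_comap]
      rw [comm_mul_pairDer]
      refine add_mem ?_ (c.mul_pairDer_mem (ih a s hs) θ)
      have e : s * pairFun k V (θ a) = comm (θ a) s + pairFun k V (θ a) * s := by
        rw [comm_apply]
        abel
      rw [e]
      exact add_mem (c.filt_le_succ _ (ih _ s hs)) (c.pairFun_mul_mem _ _ s hs)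

theorem mul_pairFun_mem (b : O) (n : ℕ) : ∀ s ∈ c.filt n, s * pairFun k V b ∈ c.filt n := by
  intro s hs
  have e : s * pairFun k V b = comm b s + pairFun k V b * s := by
    rw [comm_apply]
    abel
  rw [e]
  refine add_mem ?_ (c.pairFun_mul_mem _ _ s hs)
  rcases n with _ | n
  · obtain rfl : s = 0 := hs
    simp
  · exact c.filt_le_succ _ (c.comm_mem b n s hs)

theorem mul_mem_filt {m : ℕ} {s : Pairs k O V} (hs : s ∈ c.filt m) (n : ℕ) :
    ∀ t ∈ c.filt n, s * t ∈ c.filt (m + n) := by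
  induction n with
  | zero =>
    intro t ht
    obtain rfl : t = 0 := ht
    simp
  | succ n ih =>
    refine c.filt_succ_le (A := (c.filt (m + n + 1)).comap (AddMonoidHom.mulLeft s))
      (fun a => ?_) (fun t ht θ => ?_)
    · exact c.filt_mono (show m ≤ m + n + 1 by omega) (c.mul_pairFun_mem a m s hs)
    · rw [AddSubgroup.mem_comap, AddMonoidHom.coe_mulLeft]
      rw [← mul_assoc]
      exact c.mul_pairDer_mem (ih t ht) θ

/-- The Euler operator attached to coordinates, minus `n`. -/
def euler (S : Finset O) (p : O → Derivation k O O) (n : ℕ) : Pairs k O V →+ Pairs k O V :=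
  (∑ x ∈ S, (AddMonoidHom.mulRight (c.pairDer (p x))).comp (comm x)) - n • AddMonoidHom.id _

theorem euler_apply (S : Finset O) (p : O → Derivation k O O) (n : ℕ) (s : Pairs k O V) :
    c.euler S p n s = (∑ x ∈ S, comm x s * c.pairDer (p x)) - n • s := by
  simp [euler]

theorem euler_mem {S : Finset O} {p : O → Derivation k O O}
    (h : ∀ a : O, KaehlerDifferential.D k O a = ∑ x ∈ S, p x a • KaehlerDifferential.D k O x)
    (n : ℕ) : ∀ s ∈ c.filt (n + 1), c.euler S p n s ∈ c.filt n := by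
  induction n with
  | zero =>
    refine c.filt_succ_le (A := (c.filt 0).comap (c.euler S p 0)) (fun b => ?_) (fun s hs θ => ?_)
    · rw [AddSubgroup.mem_comap]
      simp [euler_apply, comm_pairFun]
    · obtain rfl : s = 0 := hs
      simp
  | succ n ih =>
    refine c.filt_succ_le (A := (c.filt (n + 1)).comap (c.euler S p (n + 1)))
      (fun b => ?_) (fun s hs θ => ?_)
    · rw [AddSubgroup.mem_comap]
      simp only [euler_apply, comm_pairFun, zero_mul, Finset.sum_const_zero, zero_sub]
      exact neg_mem (nsmul_mem (c.pairFun_mem _ _) _)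
    · rw [AddSubgroup.mem_comap]
      have hθ : θ = ∑ x ∈ S, θ x • p x := by
        ext a
        have h1 := derivation_eq_sum h θ a
        have h2 := congrFun (map_sum (Derivation.coeFnAddMonoidHom (R := k) (A := O) (M := O))
          (fun x => θ x • p x) S) a
        rw [Finset.sum_apply] at h2
        refine h1.trans (Eq.trans ?_ h2.symm)
        exact Finset.sum_congr rfl fun x _ => mul_comm _ _
      have e1 : ∑ x ∈ S, s * (pairFun k V (θ x) * c.pairDer (p x)) = s * c.pairDer θ := by
        conv_rhs => rw [hθ, pairDer_sum, Finset.mul_sum]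
      have e : c.euler S p (n + 1) (s * c.pairDer θ) = c.euler S p n s * c.pairDer θ +
          ∑ x ∈ S, comm x s * c.pairDer ⁅θ, p x⁆ := by
        rw [euler_apply, euler_apply]
        simp only [comm_mul_pairDer, add_mul, Finset.sum_add_distrib, pairDer_lie, mul_sub,
          Finset.sum_sub_distrib, e1, sub_mul, Finset.sum_mul, mul_assoc, add_smul, one_smul,
          smul_mul_assoc]
        abel
      rw [e]
      exact add_mem (c.mul_pairDer_mem (ih s hs) θ)
        (sum_mem fun x _ => c.mul_pairDer_mem (c.comm_mem x n s hs) _)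

variable [CharZero k] [Algebra.Smooth k O]

theorem eq_zero_of_fst (n : ℕ) : ∀ s ∈ c.filt n, s.1 = 0 → s = 0 := by
  obtain ⟨S, p, h⟩ := exists_coords k O
  induction n with
  | zero => exact fun s hs _ => hs
  | succ n ih =>
    intro s hs hs1
    have hc : ∀ x, comm x s = 0 := fun x => by
      refine ih _ (c.comm_mem x n s hs) ?_
      simp [comm_apply, hs1]
    have hE := c.euler_mem h n s hs
    rw [euler_apply] at hE
    simp only [hc, zero_mul, Finset.sum_const_zero, zero_sub] at hE
    have hns : n • s = 0 := ih _ (by simpa using neg_mem hE) (by simp [hs1])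
    rcases Nat.eq_zero_or_pos n with rfl | hn
    · have : c.filt 1 ≤ (pairFun k V (O := O)).toAddMonoidHom.range := by
        refine c.filt_succ_le (fun a => ⟨a, rfl⟩) (fun t ht θ => ?_)
        obtain rfl : t = 0 := ht
        simp
      obtain ⟨b, rfl⟩ := this hs
      have hb := LinearMap.congr_fun hs1 1
      have hb' : b = 0 := by simpa [pairFun, ofFun] using hb
      simp [hb']
    · have e : pairFun k V (algebraMap k O (n : k)⁻¹) * n • s = s := by
        have hn' : (n : k) ≠ 0 := by exact_mod_cast hn.ne'
        rw [nsmul_eq_mul, ← mul_assoc, ← map_natCast (pairFun k V) n, ← map_mul,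
          ← map_natCast (algebraMap k O) n, ← map_mul, inv_mul_cancel₀ hn', map_one, map_one,
          one_mul]
      rw [← e, hns, mul_zero]

theorem exists_lift (P : DiffOp k O) : ∃ s : Pairs k O V, (∃ n, s ∈ c.filt n) ∧ s.1 = P := by
  refine diffOp_induction k O (motive := fun P => ∃ s : Pairs k O V,
    (∃ n, s ∈ c.filt n) ∧ s.1 = P) (fun a => ?_) (fun θ => ?_) ?_ ?_ P
  · exact ⟨pairFun k V a, ⟨1, c.pairFun_mem 0 a⟩, rfl⟩
  · exact ⟨pairFun k V 1 * c.pairDer θ, ⟨2, c.mul_pairDer_mem (c.pairFun_mem 0 1) θ⟩, by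
      simp [pairDer, ofDer]⟩
  · rintro P Q ⟨s, ⟨m, hs⟩, hsP⟩ ⟨t, ⟨n, ht⟩, htQ⟩
    exact ⟨s + t, ⟨max m n, add_mem (c.filt_mono (le_max_left _ _) hs)
      (c.filt_mono (le_max_right _ _) ht)⟩, by simp [hsP, htQ]⟩
  · rintro P Q ⟨s, ⟨m, hs⟩, hsP⟩ ⟨t, ⟨n, ht⟩, htQ⟩
    exact ⟨s * t, ⟨m + n, c.mul_mem_filt hs n t ht⟩, by simp [hsP, htQ]⟩

/-- The operator on `V` by which a differential operator acts. -/
def actFun (P : DiffOp k O) : AddMonoid.End V := (c.exists_lift P).choose.2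

theorem actFun_eq {P : DiffOp k O} {s : Pairs k O V} {n : ℕ} (hs : s ∈ c.filt n) (hP : s.1 = P) :
    c.actFun P = s.2 := by
  obtain ⟨⟨m, hm⟩, h⟩ := (c.exists_lift P).choose_spec
  have := c.eq_zero_of_fst (max m n) _ (sub_mem (c.filt_mono (le_max_left _ _) hm)
    (c.filt_mono (le_max_right _ _) hs)) (by simp [h, hP])
  rw [sub_eq_zero] at this
  exact congrArg Prod.snd this

/-- The action of the ring `D` on an `O`-module with a flat connection: it is the unique one for
which functions act by scalar multiplication and vector fields act through the connection. -/
def act : DiffOp k O →+* AddMonoid.End V where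
  toFun := c.actFun
  map_one' := c.actFun_eq (s := pairFun k V 1) (c.pairFun_mem 0 1) (by simp) |>.trans (by simp)
  map_zero' := c.actFun_eq (zero_mem (c.filt 0)) (by simp)
  map_add' P Q := by
    obtain ⟨s, ⟨m, hs⟩, hsP⟩ := c.exists_lift P
    obtain ⟨t, ⟨n, ht⟩, htQ⟩ := c.exists_lift Q
    rw [c.actFun_eq hs hsP, c.actFun_eq ht htQ,
      c.actFun_eq (add_mem (c.filt_mono (le_max_left m n) hs) (c.filt_mono (le_max_right m n) ht))
        (P := P + Q) (by simp [hsP, htQ])]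
    rfl
  map_mul' P Q := by
    obtain ⟨s, ⟨m, hs⟩, hsP⟩ := c.exists_lift P
    obtain ⟨t, ⟨n, ht⟩, htQ⟩ := c.exists_lift Q
    rw [c.actFun_eq hs hsP, c.actFun_eq ht htQ,
      c.actFun_eq (c.mul_mem_filt hs n t ht) (P := P * Q) (by simp [hsP, htQ])]
    rfl

theorem act_ofFun (a : O) (v : V) : c.act (ofFun k O a) v = a • v :=
  DFunLike.congr_fun (c.actFun_eq (s := pairFun k V a) (c.pairFun_mem 0 a) rfl) v

theorem act_ofDer (θ : Derivation k O O) (v : V) : c.act (ofDer θ) v = c.nabla θ v :=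
  DFunLike.congr_fun ((c.actFun_eq (s := pairFun k V 1 * c.pairDer θ)
    (c.mul_pairDer_mem (c.pairFun_mem 0 1) θ) (by simp [pairDer, ofDer])).trans
      (by simp only [map_one, one_mul]; rfl)) v

end FlatConnection

end Extension

namespace FlatConnection

variable {k : Type v} {O : Type u} [Field k] [CommRing O] [Algebra k O]
variable {V W : Type u} [AddCommGroup V] [Module O V] [AddCommGroup W] [Module O W]

/-- The Leibniz action of a vector field on a tensor product over `O`:
`θ (v ⊗ w) = θ v ⊗ w + v ⊗ θ w`. -/
def tensorNabla (c : FlatConnection k O V) (d : FlatConnection k O W) (θ : Derivation k O O) :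
    V ⊗[O] W →+ V ⊗[O] W :=
  TensorProduct.liftAddHom
    (AddMonoidHom.mk' (fun v => AddMonoidHom.mk' (fun w => c.nabla θ v ⊗ₜ[O] w + v ⊗ₜ d.nabla θ w)
        (fun w w' => by simp only [map_add, tmul_add]; abel))
      (fun v v' => by
        ext w
        simp only [AddMonoidHom.mk'_apply, AddMonoidHom.add_apply, map_add, add_tmul]
        abel))
    (fun a v w => by
      simp only [AddMonoidHom.mk'_apply, c.leibniz, d.leibniz, add_tmul, tmul_add, smul_tmul]
      abel)

theorem tensorNabla_tmul (c : FlatConnection k O V) (d : FlatConnection k O W)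
    (θ : Derivation k O O) (v : V) (w : W) :
    tensorNabla c d θ (v ⊗ₜ w) = c.nabla θ v ⊗ₜ[O] w + v ⊗ₜ d.nabla θ w := rfl

/-- The tensor product over `O` of two flat connections. -/
def tensor (c : FlatConnection k O V) (d : FlatConnection k O W) :
    FlatConnection k O (V ⊗[O] W) where
  nabla := tensorNabla c d
  nabla_add θ η x := by
    induction x with
    | zero => simp
    | tmul v w =>
      simp only [tensorNabla_tmul, nabla_add, add_tmul, tmul_add]
      abel
    | add x y hx hy =>
      simp only [map_add, hx, hy]
      abel
  nabla_smul a θ x := by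
    induction x with
    | zero => simp
    | tmul v w => simp only [tensorNabla_tmul, nabla_smul, smul_add, smul_tmul', tmul_smul]
    | add x y hx hy => simp only [map_add, hx, hy, smul_add]
  leibniz θ a x := by
    induction x with
    | zero => simp
    | tmul v w =>
      simp only [smul_tmul', tensorNabla_tmul, leibniz, add_tmul, smul_add, add_assoc]
    | add x y hx hy =>
      simp only [map_add, hx, hy, smul_add]
      abel
  nabla_lie θ η x := by
    induction x with
    | zero => simp
    | tmul v w =>
      simp only [tensorNabla_tmul, nabla_lie, sub_tmul, tmul_sub, map_add]
      abel
    | add x y hx hy =>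
      simp only [map_add, hx, hy]
      abel

end FlatConnection

section Category

variable (k : Type v) (O : Type u) [Field k] [CommRing O] [Algebra k O]

/-- The category of (left) modules over the ring `D` of differential operators. -/
abbrev DModCat := ModuleCat.{u} (DiffOp k O)

/-- The underlying `O`-module of a `D`-module. -/
abbrev toO : DModCat k O ⥤ ModuleCat.{u} O := ModuleCat.restrictScalars (ofFun k O)

variable {k O}

/-- The flat connection underlying a `D`-module: vector fields are elements of `D`. -/
def conn (M : DModCat k O) : FlatConnection k O ((toO k O).obj M) where
  nabla θ := DistribSMul.toAddMonoidHom M (ofDer θ)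
  nabla_add θ η (m : M) := by
    change ofDer (θ + η) • m = ofDer θ • m + ofDer η • m
    rw [ofDer_add, add_smul]
  nabla_smul a θ (m : M) := by
    change ofDer (a • θ) • m = ofFun k O a • ofDer θ • m
    rw [ofDer_smul, mul_smul]
  leibniz θ a (m : M) := by
    change ofDer θ • ofFun k O a • m = ofFun k O (θ a) • m + ofFun k O a • ofDer θ • m
    rw [← mul_smul, ofDer_mul_ofFun, add_smul, mul_smul, add_comm]
  nabla_lie θ η (m : M) := by
    change ofDer ⁅θ, η⁆ • m = ofDer θ • ofDer η • m - ofDer η • ofDer θ • m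
    rw [ofDer_lie, sub_smul, mul_smul, mul_smul]

variable [CharZero k] [Algebra.Smooth k O]

/-- An `O`-linear map between `D`-modules that commutes with vector fields is `D`-linear. -/
def homMk {M N : DModCat k O} (f : (toO k O).obj M ⟶ (toO k O).obj N)
    (hf : ∀ θ m, f ((conn M).nabla θ m) = (conn N).nabla θ (f m)) : M ⟶ N :=
  ModuleCat.ofHom
    { toFun := fun m : M => (f m : N)
      map_add' := fun m m' => f.hom.map_add m m'
      map_smul' := fun P => by
        refine diffOp_induction k O (motive := fun P => ∀ m : M, (f (P • m : M) : N) =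
          P • (f m : N)) (fun a m => f.hom.map_smul a m) (fun θ m => hf θ m) ?_ ?_ P
        · intro P Q hP hQ m
          rw [add_smul, add_smul, ← hP, ← hQ]
          exact f.hom.map_add _ _
        · intro P Q hP hQ m
          rw [mul_smul, mul_smul, hP, hQ] }

theorem toO_map_homMk {M N : DModCat k O} (f : (toO k O).obj M ⟶ (toO k O).obj N)
    (hf : ∀ θ m, f ((conn M).nabla θ m) = (conn N).nabla θ (f m)) :
    (toO k O).map (homMk f hf) = f := rfl

/-- An `O`-linear isomorphism between `D`-modules that commutes with vector fields
is an isomorphism of `D`-modules. -/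
def isoMk {M N : DModCat k O} (e : (toO k O).obj M ≅ (toO k O).obj N)
    (he : ∀ θ m, e.hom ((conn M).nabla θ m) = (conn N).nabla θ (e.hom m)) : M ≅ N where
  hom := homMk e.hom he
  inv := homMk e.inv fun θ n => by
    have := he θ (e.inv n)
    have h1 : e.hom (e.inv n) = n := by simp
    rw [h1] at this
    rw [← this]
    simp
  hom_inv_id := (toO k O).map_injective (by
    rw [Functor.map_comp, toO_map_homMk, toO_map_homMk, e.hom_inv_id, CategoryTheory.Functor.map_id])
  inv_hom_id := (toO k O).map_injective (by
    rw [Functor.map_comp, toO_map_homMk, toO_map_homMk, e.inv_hom_id, CategoryTheory.Functor.map_id])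

/-- The carrier of the tensor product of `D`-modules: the tensor product over `O`. -/
def TensorCarrier (M N : DModCat k O) : Type u := (toO k O).obj M ⊗[O] (toO k O).obj N

instance (M N : DModCat k O) : AddCommGroup (TensorCarrier M N) :=
  inferInstanceAs (AddCommGroup ((toO k O).obj M ⊗[O] (toO k O).obj N))

/-- `D` acts on `M ⊗_O N`: functions act by scalar multiplication
and vector fields act by the Leibniz rule. -/
@[reducible]
def tensorModule (M N : DModCat k O) :
    Module (DiffOp k O) ((toO k O).obj M ⊗[O] (toO k O).obj N) :=
  Module.compHom _ ((conn M).tensor (conn N)).act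

instance (M N : DModCat k O) : Module (DiffOp k O) (TensorCarrier M N) := tensorModule M N

/-- The tensor product over `O` of two `D`-modules. -/
def tensorDMod (M N : DModCat k O) : DModCat k O := ModuleCat.of _ (TensorCarrier M N)

/-- The `O`-module underlying the tensor product of `D`-modules is the tensor product of the
underlying `O`-modules. -/
def muEquiv (M N : DModCat k O) :
    ((toO k O).obj M ⊗[O] (toO k O).obj N) ≃ₗ[O] (toO k O).obj (tensorDMod M N) where
  toFun x := x
  invFun x := x
  left_inv _ := rfl
  right_inv _ := rfl
  map_add' _ _ := rfl
  map_smul' a x := (((conn M).tensor (conn N)).act_ofFun a x).symm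

/-- The isomorphism of `O`-modules `muEquiv`. -/
def muIso (M N : DModCat k O) :
    MonoidalCategoryStruct.tensorObj ((toO k O).obj M) ((toO k O).obj N) ≅
      (toO k O).obj (tensorDMod M N) :=
  (muEquiv M N).toModuleIso

/-- The `D`-module `O`, with the tautological action of differential operators. -/
def unitDMod : DModCat k O := ModuleCat.of _ O

/-- The `O`-module underlying the `D`-module `O` is `O`. -/
def epsEquiv : O ≃ₗ[O] (toO k O).obj (unitDMod (k := k) (O := O)) where
  toFun x := x
  invFun x := x
  left_inv _ := rfl
  right_inv _ := rfl
  map_add' _ _ := rfl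
  map_smul' _ _ := rfl

/-- The isomorphism of `O`-modules `epsEquiv`. -/
def epsIso : 𝟙_ (ModuleCat.{u} O) ≅ (toO k O).obj (unitDMod (k := k) (O := O)) :=
  epsEquiv.toModuleIso

theorem muIso_tmul_nabla (M N : DModCat k O) (θ : Derivation k O O) (m : (toO k O).obj M)
    (n : (toO k O).obj N) :
    (conn (tensorDMod M N)).nabla θ ((muIso M N).hom (m ⊗ₜ[O] n)) =
      (muIso M N).hom ((conn M).nabla θ m ⊗ₜ[O] n) +
        (muIso M N).hom (m ⊗ₜ[O] (conn N).nabla θ n) :=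
  ((conn M).tensor (conn N)).act_ofDer θ (m ⊗ₜ[O] n)

end Category

section Monoidal

variable {k : Type v} {O : Type u} [Field k] [CommRing O] [Algebra k O]

theorem conn_map {M N : DModCat k O} (f : M ⟶ N) (θ : Derivation k O O) (m : (toO k O).obj M) :
    (toO k O).map f ((conn M).nabla θ m) = (conn N).nabla θ ((toO k O).map f m) :=
  f.hom.map_smul (ofDer θ) m

variable [CharZero k] [Algebra.Smooth k O]

theorem muIso_induction {M N : DModCat k O} {motive : (toO k O).obj (tensorDMod M N) → Prop}
    (h : ∀ m n, motive ((muIso M N).hom (m ⊗ₜ[O] n)))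
    (hadd : ∀ x y, motive x → motive y → motive (x + y)) (x) : motive x := by
  have key : ∀ y : (toO k O).obj M ⊗[O] (toO k O).obj N, motive ((muIso M N).hom y) := by
    intro y
    induction y with
    | zero =>
      have := h 0 0
      rwa [zero_tmul] at this
    | tmul m n => exact h m n
    | add x y hx hy =>
      have := hadd _ _ hx hy
      rwa [← map_add] at this
  exact key ((muIso M N).inv x)

/-- The tensor product of morphisms of `D`-modules. -/
def tensorHomDMod {M N M' N' : DModCat k O} (f : M ⟶ N) (g : M' ⟶ N') :
    tensorDMod M M' ⟶ tensorDMod N N' :=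
  homMk ((muIso M M').inv ≫ MonoidalCategoryStruct.tensorHom ((toO k O).map f) ((toO k O).map g) ≫
      (muIso N N').hom) (fun θ x => by
    induction x using muIso_induction with
    | h m n =>
      rw [muIso_tmul_nabla]
      change (muIso N N').hom ((toO k O).map f ((conn M).nabla θ m) ⊗ₜ[O] (toO k O).map g n) +
        (muIso N N').hom ((toO k O).map f m ⊗ₜ[O] (toO k O).map g ((conn M').nabla θ n)) =
        (conn _).nabla θ ((muIso N N').hom ((toO k O).map f m ⊗ₜ[O] (toO k O).map g n))
      rw [muIso_tmul_nabla, conn_map, conn_map]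
    | hadd x y hx hy => simp only [map_add, hx, hy])

theorem toO_map_tensorHomDMod {M N M' N' : DModCat k O} (f : M ⟶ N) (g : M' ⟶ N') :
    (toO k O).map (tensorHomDMod f g) = (muIso M M').inv ≫
      MonoidalCategoryStruct.tensorHom ((toO k O).map f) ((toO k O).map g) ≫ (muIso N N').hom :=
  rfl

/-- The associativity isomorphism `(M ⊗ N) ⊗ P ≅ M ⊗ (N ⊗ P)`. -/
def assocDMod (M N P : DModCat k O) :
    tensorDMod (tensorDMod M N) P ≅ tensorDMod M (tensorDMod N P) :=
  isoMk (((muIso _ _).symm ≪≫ ((muIso _ _).symm ⊗ᵢ .refl _))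
        ≪≫ α_ ((toO k O).obj M) ((toO k O).obj N) ((toO k O).obj P)
        ≪≫ ((.refl _ ⊗ᵢ muIso _ _) ≪≫ muIso _ _)) (fun θ x => by
    induction x using muIso_induction with
    | h y p =>
      induction y using muIso_induction with
      | h m n =>
        rw [muIso_tmul_nabla, muIso_tmul_nabla, add_tmul, map_add, map_add, map_add]
        change (muIso _ _).hom ((conn M).nabla θ m ⊗ₜ[O] (muIso _ _).hom (n ⊗ₜ[O] p)) +
          (muIso _ _).hom (m ⊗ₜ[O] (muIso _ _).hom ((conn N).nabla θ n ⊗ₜ[O] p)) +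
          (muIso _ _).hom (m ⊗ₜ[O] (muIso _ _).hom (n ⊗ₜ[O] (conn P).nabla θ p)) =
          (conn _).nabla θ ((muIso M (tensorDMod N P)).hom (m ⊗ₜ[O] (muIso N P).hom (n ⊗ₜ[O] p)))
        rw [muIso_tmul_nabla, muIso_tmul_nabla, tmul_add, map_add, add_assoc]
      | hadd x y hx hy => simp only [add_tmul, map_add, hx, hy]
    | hadd x y hx hy => simp only [map_add, hx, hy])

/-- The left unit isomorphism `O ⊗ M ≅ M`. -/
def leftUnitorDMod (M : DModCat k O) : tensorDMod unitDMod M ≅ M :=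
  isoMk (((muIso _ _).symm ≪≫ (epsIso.symm ⊗ᵢ .refl _)) ≪≫ λ_ ((toO k O).obj M)) (fun θ x => by
    induction x using muIso_induction with
    | h a m =>
      rw [muIso_tmul_nabla, map_add]
      exact ((conn M).leibniz θ a m).symm
    | hadd x y hx hy => simp only [map_add, hx, hy])

/-- The right unit isomorphism `M ⊗ O ≅ M`. -/
def rightUnitorDMod (M : DModCat k O) : tensorDMod M unitDMod ≅ M :=
  isoMk (((muIso _ _).symm ≪≫ (.refl _ ⊗ᵢ epsIso.symm)) ≪≫ ρ_ ((toO k O).obj M)) (fun θ x => by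
    induction x using muIso_induction with
    | h m a =>
      rw [muIso_tmul_nabla, map_add, add_comm]
      exact ((conn M).leibniz θ a m).symm
    | hadd x y hx hy => simp only [map_add, hx, hy])

/-- The symmetry `M ⊗ N ≅ N ⊗ M`. -/
def braidingDMod (M N : DModCat k O) : tensorDMod M N ≅ tensorDMod N M :=
  isoMk ((muIso _ _).symm ≪≫ β_ ((toO k O).obj M) ((toO k O).obj N) ≪≫ muIso _ _) (fun θ x => by
    induction x using muIso_induction with
    | h m n =>
      rw [muIso_tmul_nabla, map_add, add_comm]
      exact (muIso_tmul_nabla N M θ n m).symm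
    | hadd x y hx hy => simp only [map_add, hx, hy])

instance : MonoidalCategoryStruct (DModCat k O) where
  tensorObj := tensorDMod
  whiskerLeft M _ _ f := tensorHomDMod (𝟙 M) f
  whiskerRight f N := tensorHomDMod f (𝟙 N)
  tensorHom f g := tensorHomDMod f g
  tensorUnit := unitDMod
  associator := assocDMod
  leftUnitor := leftUnitorDMod
  rightUnitor := rightUnitorDMod

/-- The forgetful functor to `O`-modules is compatible with tensor products. -/
def inducingData : Monoidal.InducingFunctorData (toO k O) where
  μIso := muIso
  whiskerLeft_eq M _ _ f := (toO_map_tensorHomDMod (𝟙 M) f).trans (by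
    rw [CategoryTheory.Functor.map_id, id_tensorHom])
  whiskerRight_eq f N := (toO_map_tensorHomDMod f (𝟙 N)).trans (by
    rw [CategoryTheory.Functor.map_id, tensorHom_id])
  tensorHom_eq _ _ := rfl
  εIso := epsIso
  associator_eq _ _ _ := rfl
  leftUnitor_eq _ := rfl
  rightUnitor_eq _ := rfl

/-- The monoidal category `(DM, ⊗_O, O)`. -/
instance : MonoidalCategory (DModCat k O) := Monoidal.induced (toO k O) inducingData

instance : (toO k O).Monoidal := Monoidal.fromInducedMonoidal (toO k O) inducingData

instance : BraidedCategory (DModCat k O) :=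
  BraidedCategory.ofFaithful (toO k O) braidingDMod (fun M N => by
    change (muIso M N).hom ≫ (muIso M N).inv ≫ (β_ _ _).hom ≫ (muIso N M).hom =
      (β_ _ _).hom ≫ (muIso N M).hom
    rw [Iso.hom_inv_id_assoc])

instance : SymmetricCategory (DModCat k O) where
  symmetry M N := (toO k O).map_injective (by
    rw [Functor.map_comp, CategoryTheory.Functor.map_id]
    change ((muIso M N).inv ≫ (β_ _ _).hom ≫ (muIso N M).hom) ≫
      (muIso N M).inv ≫ (β_ _ _).hom ≫ (muIso M N).hom = 𝟙 _
    simp)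

instance : MonoidalPreadditive (DModCat k O) :=
  monoidalPreadditive_of_faithful (toO k O)

end Monoidal

section Koszul

variable {C : Type u} [Category.{v} C] [MonoidalCategory C] [Preadditive C]
  [MonoidalPreadditive C] [HasZeroObject C] [HasFiniteCoproducts C] [SymmetricCategory C]

open GradedObject.Monoidal

/-- The Koszul sign `(-1) ^ (p q)`. -/
def sgn (p q : ℕ) : ℤˣ := (-1) ^ (p * q)

theorem sgn_symm (p q : ℕ) : sgn q p = sgn p q := by rw [sgn, sgn, mul_comm]

theorem sgn_mul_self (p q : ℕ) : sgn p q * sgn p q = 1 := Int.units_mul_self _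

theorem sgn_add_right (p q r : ℕ) : sgn p (q + r) = sgn p q * sgn p r := by
  rw [sgn, mul_add, pow_add]; rfl

theorem sgn_add_left (p q r : ℕ) : sgn (p + q) r = sgn p r * sgn q r := by
  rw [sgn, add_mul, pow_add]; rfl

variable (X Y Z : GradedObject ℕ C)

/-- The symmetry of the tensor product of graded objects, with the Koszul sign. -/
def gradedBraidingHom : GradedObject.Monoidal.tensorObj X Y ⟶ GradedObject.Monoidal.tensorObj Y X :=
  fun n => tensorObjDesc (fun p q h => sgn p q • ((β_ (X p) (Y q)).hom ≫
    ιTensorObj Y X q p n ((add_comm q p).trans h)))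

theorem ι_gradedBraidingHom (p q n : ℕ) (h : p + q = n) :
    ιTensorObj X Y p q n h ≫ gradedBraidingHom X Y n = sgn p q • ((β_ (X p) (Y q)).hom ≫
    ιTensorObj Y X q p n ((add_comm q p).trans h)) :=
  ι_tensorObjDesc _ _ _ _

theorem gradedBraidingHom_symm : gradedBraidingHom X Y ≫ gradedBraidingHom Y X = 𝟙 _ := by
  funext n
  refine tensorObj_ext _ _ (fun p q h => ?_)
  change _ ≫ gradedBraidingHom X Y n ≫ gradedBraidingHom Y X n = _ ≫ 𝟙 _
  rw [← Category.assoc, ι_gradedBraidingHom, Linear.units_smul_comp, Category.assoc,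
    ι_gradedBraidingHom, Linear.comp_units_smul, smul_smul, sgn_symm, sgn_mul_self, one_smul,
    SymmetricCategory.symmetry_assoc]
  exact (Category.comp_id _).symm

theorem gradedBraiding_naturality {X X' Y Y' : GradedObject ℕ C} (f : X ⟶ X') (g : Y ⟶ Y') :
    GradedObject.Monoidal.tensorHom f g ≫ gradedBraidingHom X' Y' =
      gradedBraidingHom X Y ≫ GradedObject.Monoidal.tensorHom g f := by
  funext n
  refine tensorObj_ext _ _ (fun p q h => ?_)
  change _ ≫ GradedObject.Monoidal.tensorHom f g n ≫ gradedBraidingHom X' Y' n = 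
    _ ≫ gradedBraidingHom X Y n ≫ GradedObject.Monoidal.tensorHom g f n
  rw [ι_tensorHom_assoc, ι_gradedBraidingHom, ← Category.assoc (ιTensorObj X Y p q n h),
    ι_gradedBraidingHom, Linear.comp_units_smul, Linear.units_smul_comp, Category.assoc,
    ι_tensorHom, BraidedCategory.braiding_naturality_assoc]

theorem ι_gradedBraidingHom_assoc (p q n : ℕ) (h : p + q = n) {W : C}
    (f : GradedObject.Monoidal.tensorObj Y X n ⟶ W) :
    ιTensorObj X Y p q n h ≫ gradedBraidingHom X Y n ≫ f = sgn p q • ((β_ (X p) (Y q)).hom ≫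
    ιTensorObj Y X q p n ((add_comm q p).trans h) ≫ f) := by
  rw [← Category.assoc, ι_gradedBraidingHom, Linear.units_smul_comp, Category.assoc]

theorem whiskerLeft_units_smul (A : C) {B B' : C} (s : ℤˣ) (f : B ⟶ B') :
    A ◁ (s • f) = s • (A ◁ f) :=
  (tensorLeft A).map_units_smul s f

theorem units_smul_whiskerRight (A : C) {B B' : C} (s : ℤˣ) (f : B ⟶ B') :
    (s • f) ▷ A = s • (f ▷ A) :=
  (tensorRight A).map_units_smul s f

theorem ι_whiskerRight_gradedBraidingHom (p q r n m : ℕ) (h : m + r = n) (h' : p + q = m) {W : C}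
    (F : GradedObject.Monoidal.tensorObj (GradedObject.Monoidal.tensorObj Y X) Z n ⟶ W) :
    ιTensorObj X Y p q m h' ▷ Z r ≫ 
    ιTensorObj (GradedObject.Monoidal.tensorObj X Y) Z m r n h ≫
      GradedObject.Monoidal.whiskerRight (gradedBraidingHom X Y) Z n ≫ F =
    sgn p q • ((β_ (X p) (Y q)).hom ▷ Z r ≫ ιTensorObj Y X q p m ((add_comm q p).trans h') ▷ Z r ≫
     ιTensorObj (GradedObject.Monoidal.tensorObj Y X) Z m r n h ≫ F) := by
  have h1 := ι_tensorHom (gradedBraidingHom X Y) (𝟙 Z) m r n h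
  rw [← Category.assoc (ιTensorObj (GradedObject.Monoidal.tensorObj X Y) Z m r n h)]
  erw [h1]
  rw [Category.assoc, ← tensorHom_id, MonoidalCategory.tensorHom_comp_tensorHom_assoc, ι_gradedBraidingHom,
    GradedObject.categoryOfGradedObjects_id, Category.comp_id, tensorHom_id,
    units_smul_whiskerRight, Linear.units_smul_comp, comp_whiskerRight, Category.assoc]

theorem ι_whiskerLeft_gradedBraidingHom (p q r n m : ℕ) (h : r + m = n) (h' : p + q = m) :
    Z r ◁ ιTensorObj X Y p q m h' ≫ 
    ιTensorObj Z (GradedObject.Monoidal.tensorObj X Y) r m n h ≫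
      GradedObject.Monoidal.whiskerLeft Z (gradedBraidingHom X Y) n =
    sgn p q • (Z r ◁ (β_ (X p) (Y q)).hom ≫ Z r ◁ ιTensorObj Y X q p m ((add_comm q p).trans h') ≫
     ιTensorObj Z (GradedObject.Monoidal.tensorObj Y X) r m n h) := by
  have h1 := ι_tensorHom (𝟙 Z) (gradedBraidingHom X Y) r m n h
  erw [h1]
  rw [← id_tensorHom, MonoidalCategory.tensorHom_comp_tensorHom_assoc, ι_gradedBraidingHom,
    GradedObject.categoryOfGradedObjects_id, Category.comp_id, id_tensorHom,
    whiskerLeft_units_smul, Linear.units_smul_comp, MonoidalCategory.whiskerLeft_comp,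
    Category.assoc]

theorem gradedBraiding_hexagon :
    (GradedObject.Monoidal.associator X Y Z).hom ≫
      gradedBraidingHom X (GradedObject.Monoidal.tensorObj Y Z) ≫
        (GradedObject.Monoidal.associator Y Z X).hom =
      GradedObject.Monoidal.whiskerRight (gradedBraidingHom X Y) Z ≫
        (GradedObject.Monoidal.associator Y X Z).hom ≫
        GradedObject.Monoidal.whiskerLeft Y (gradedBraidingHom X Z) := by
  funext n
  refine tensorObj₃'_ext _ _ (fun i₁ i₂ i₃ h => ?_)
  change _ ≫ (GradedObject.Monoidal.associator X Y Z).hom n ≫ gradedBraidingHom X _ n ≫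
        (GradedObject.Monoidal.associator Y Z X).hom n =
      _ ≫ GradedObject.Monoidal.whiskerRight (gradedBraidingHom X Y) Z n ≫
        (GradedObject.Monoidal.associator Y X Z).hom n ≫
        GradedObject.Monoidal.whiskerLeft Y (gradedBraidingHom X Z) n
  rw [ιTensorObj₃'_associator_hom_assoc, ιTensorObj₃_eq X Y Z i₁ i₂ i₃ n h _ rfl,
    Category.assoc, ι_gradedBraidingHom_assoc, Linear.comp_units_smul, Linear.comp_units_smul,
    ← id_tensorHom,
    BraidedCategory.braiding_naturality_assoc,
    BraidedCategory.braiding_tensor_right_hom, Category.assoc, Category.assoc, Category.assoc,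
    Category.assoc, Iso.hom_inv_id_assoc, tensorHom_id,
    ← ιTensorObj₃'_eq_assoc Y Z X i₂ i₃ i₁ n (by rw [add_comm _ i₁, ← add_assoc, h]) _ rfl,
    ιTensorObj₃'_associator_hom, Iso.inv_hom_id_assoc, sgn_add_right]
  rw [ιTensorObj₃'_eq X Y Z i₁ i₂ i₃ n h _ rfl, Category.assoc, ι_whiskerRight_gradedBraidingHom,
    ← ιTensorObj₃'_eq_assoc Y X Z i₂ i₁ i₃ n
      (by rw [add_comm i₂ i₁, h]) (i₁ + i₂) (add_comm i₂ i₁),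
    ιTensorObj₃'_associator_hom_assoc,
    ιTensorObj₃_eq Y X Z i₂ i₁ i₃ n (by rw [add_comm i₂ i₁, h]) _ rfl, Category.assoc,
    ι_whiskerLeft_gradedBraidingHom, Linear.comp_units_smul, Linear.comp_units_smul, smul_smul,
    ← ιTensorObj₃_eq Y Z X i₂ i₃ i₁ n (by rw [add_comm _ i₁, ← add_assoc, h])
      (i₁ + i₃) (add_comm _ _)]

end Koszul

section KoszulComplex

variable {C : Type u} [Category.{v} C] [MonoidalCategory C] [Preadditive C]
  [MonoidalPreadditive C] [HasZeroObject C] [HasFiniteCoproducts C] [SymmetricCategory C]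

theorem sgn_succ_left (p q : ℕ) : sgn (p + 1) q = sgn p q * (-1) ^ q := by
  rw [sgn_add_left]; simp [sgn]

theorem sgn_succ_right (p q : ℕ) : sgn p (q + 1) = sgn p q * (-1) ^ p := by
  rw [sgn_add_right]; simp [sgn]

/-- The components of the symmetry of the tensor product of chain complexes. -/
def koszulX (K L : ChainComplex C ℕ) (n : ℕ) :
    (HomologicalComplex.tensorObj K L).X n ⟶ (HomologicalComplex.tensorObj L K).X n :=
  HomologicalComplex.mapBifunctorDesc (fun p q h => sgn p q • ((β_ (K.X p) (L.X q)).hom ≫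
    HomologicalComplex.ιTensorObj L K q p n ((add_comm q p).trans h)))

theorem koszulX_eq (K L : ChainComplex C ℕ) (n : ℕ) :
    koszulX K L n = gradedBraidingHom K.X L.X n := rfl

theorem ι_koszulX (K L : ChainComplex C ℕ) (p q n : ℕ) (h : p + q = n) :
    HomologicalComplex.ιTensorObj K L p q n h ≫ koszulX K L n
      = sgn p q • ((β_ (K.X p) (L.X q)).hom ≫
        HomologicalComplex.ιTensorObj L K q p n ((add_comm q p).trans h)) :=
  HomologicalComplex.ι_mapBifunctorDesc _ _ _ _

theorem koszul_d₁ (K L : ChainComplex C ℕ) (p q n : ℕ) (h : p + q = n + 1) :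
    HomologicalComplex.mapBifunctor.d₁ K L (curriedTensor C) (.down ℕ) p q n ≫ koszulX K L n =
      sgn p q • ((β_ (K.X p) (L.X q)).hom ≫
        HomologicalComplex.mapBifunctor.d₂ L K (curriedTensor C) (.down ℕ) q p n) := by
  cases p with
  | zero =>
    rw [HomologicalComplex.mapBifunctor.d₁_eq_zero, HomologicalComplex.mapBifunctor.d₂_eq_zero,
      zero_comp, comp_zero, smul_zero] <;> simp
  | succ p =>
    have h' : p + q = n := by omega
    rw [HomologicalComplex.mapBifunctor.d₁_eq K L (curriedTensor C) (.down ℕ)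
        (show (ComplexShape.down ℕ).Rel (p + 1) p from rfl) q n h',
      HomologicalComplex.mapBifunctor.d₂_eq L K (curriedTensor C) (.down ℕ) q
        (show (ComplexShape.down ℕ).Rel (p + 1) p from rfl) n ((add_comm q p).trans h')]
    change ((1 : ℤˣ) • (K.d (p + 1) p ▷ L.X q ≫ HomologicalComplex.ιTensorObj K L p q n h')) ≫ _ =
      sgn (p + 1) q • (_ ≫ ((-1 : ℤˣ) ^ q • (L.X q ◁ K.d (p + 1) p ≫
        HomologicalComplex.ιTensorObj L K q p n ((add_comm q p).trans h'))))
    rw [one_smul, Category.assoc, ι_koszulX, Linear.comp_units_smul, Linear.comp_units_smul,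
      smul_smul, sgn_succ_left, mul_assoc, Int.units_mul_self, mul_one,
      BraidedCategory.braiding_naturality_left_assoc]

theorem koszul_d₂ (K L : ChainComplex C ℕ) (p q n : ℕ) (h : p + q = n + 1) :
    HomologicalComplex.mapBifunctor.d₂ K L (curriedTensor C) (.down ℕ) p q n ≫ koszulX K L n =
      sgn p q • ((β_ (K.X p) (L.X q)).hom ≫
        HomologicalComplex.mapBifunctor.d₁ L K (curriedTensor C) (.down ℕ) q p n) := by
  cases q with
  | zero =>
    rw [HomologicalComplex.mapBifunctor.d₁_eq_zero, HomologicalComplex.mapBifunctor.d₂_eq_zero,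
      zero_comp, comp_zero, smul_zero] <;> simp
  | succ q =>
    have h' : p + q = n := by omega
    rw [HomologicalComplex.mapBifunctor.d₂_eq K L (curriedTensor C) (.down ℕ) p
        (show (ComplexShape.down ℕ).Rel (q + 1) q from rfl) n h',
      HomologicalComplex.mapBifunctor.d₁_eq L K (curriedTensor C) (.down ℕ)
        (show (ComplexShape.down ℕ).Rel (q + 1) q from rfl) p n ((add_comm q p).trans h')]
    change ((-1 : ℤˣ) ^ p • (K.X p ◁ L.d (q + 1) q ≫
        HomologicalComplex.ιTensorObj K L p q n h')) ≫ _ =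
      sgn p (q + 1) • (_ ≫ ((1 : ℤˣ) • (L.d (q + 1) q ▷ K.X p ≫
        HomologicalComplex.ιTensorObj L K q p n ((add_comm q p).trans h'))))
    rw [one_smul, Linear.units_smul_comp, Category.assoc, ι_koszulX, Linear.comp_units_smul,
      smul_smul, sgn_succ_right, mul_comm,
      BraidedCategory.braiding_naturality_right_assoc]

/-- The symmetry of the tensor product of chain complexes, given by the Koszul sign rule
`x ⊗ y ↦ (-1) ^ (p q) y ⊗ x` for `x` in degree `p` and `y` in degree `q`. -/
def koszulHom (K L : ChainComplex C ℕ) :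
    HomologicalComplex.tensorObj K L ⟶ HomologicalComplex.tensorObj L K where
  f n := koszulX K L n
  comm' := by
    rintro _ n rfl
    refine HomologicalComplex.mapBifunctor.hom_ext (fun p q h => ?_)
    have h' : p + q = n + 1 := h
    rw [HomologicalComplex.mapBifunctor.d_eq, HomologicalComplex.mapBifunctor.d_eq,
      Preadditive.add_comp, Preadditive.comp_add, Preadditive.comp_add, Preadditive.comp_add,
      HomologicalComplex.mapBifunctor.ι_D₁_assoc, HomologicalComplex.mapBifunctor.ι_D₂_assoc,
      koszul_d₁ K L p q n h', koszul_d₂ K L p q n h', ← Category.assoc, ← Category.assoc]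
    have e := ι_koszulX K L p q (n + 1) h'
    dsimp only [HomologicalComplex.ιTensorObj] at e
    rw [e, Linear.units_smul_comp, Linear.units_smul_comp, Category.assoc, Category.assoc,
      HomologicalComplex.mapBifunctor.ι_D₁, HomologicalComplex.mapBifunctor.ι_D₂, add_comm]

theorem koszulHom_symm (K L : ChainComplex C ℕ) : koszulHom K L ≫ koszulHom L K = 𝟙 _ := by
  ext n : 1
  exact congr_fun (gradedBraidingHom_symm K.X L.X) n

/-- The symmetry isomorphism of the tensor product of chain complexes. -/
def koszulIso (K L : ChainComplex C ℕ) :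
    HomologicalComplex.tensorObj K L ≅ HomologicalComplex.tensorObj L K where
  hom := koszulHom K L
  inv := koszulHom L K
  hom_inv_id := koszulHom_symm K L
  inv_hom_id := koszulHom_symm L K

theorem koszulHom_naturality {K K' L L' : ChainComplex C ℕ} (f : K ⟶ K') (g : L ⟶ L') :
    HomologicalComplex.tensorHom f g ≫ koszulHom K' L' =
      koszulHom K L ≫ HomologicalComplex.tensorHom g f := by
  ext n : 1
  exact congr_fun (gradedBraiding_naturality (X := K.X) (X' := K'.X) (Y := L.X) (Y' := L'.X)
    f.f g.f) n

theorem koszulHom_hexagon (K L M : ChainComplex C ℕ) :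
    (HomologicalComplex.associator K L M).hom ≫ koszulHom K (HomologicalComplex.tensorObj L M) ≫
      (HomologicalComplex.associator L M K).hom =
    HomologicalComplex.tensorHom (koszulHom K L) (𝟙 M) ≫
      (HomologicalComplex.associator L K M).hom ≫
        HomologicalComplex.tensorHom (𝟙 L) (koszulHom K M) := by
  ext n : 1
  exact congr_fun (gradedBraiding_hexagon K.X L.X M.X) n

/-- The tensor product of non-negatively graded chain complexes in an additive
monoidal category: `(K ⊗ L)_n = ⨁_{p + q = n} K_p ⊗ L_q` with differential
`d (x ⊗ y) = d x ⊗ y + (-1) ^ p x ⊗ d y`. -/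
abbrev chainMonoidal : MonoidalCategory (ChainComplex C ℕ) := inferInstance

/-- The symmetric monoidal category of non-negatively graded chain complexes in a symmetric
monoidal additive category. -/
abbrev chainSymmetric : SymmetricCategory (ChainComplex C ℕ) where
  braiding := koszulIso
  braiding_naturality_right K _ _ f := koszulHom_naturality (𝟙 K) f
  braiding_naturality_left f K := koszulHom_naturality f (𝟙 K)
  hexagon_forward := koszulHom_hexagon
  hexagon_reverse K L M := by
    have h := koszulHom_hexagon M K L
    change (α_ M K L).hom ≫ (koszulIso M (K ⊗ L)).hom ≫ (α_ K L M).hom =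
      (koszulIso M K).hom ▷ L ≫ (α_ K M L).hom ≫ K ◁ (koszulIso M L).hom at h
    change (α_ K L M).inv ≫ (koszulIso M (K ⊗ L)).inv ≫ (α_ M K L).inv =
      K ◁ (koszulIso M L).inv ≫ (α_ K M L).inv ≫ (koszulIso M K).inv ▷ L
    rw [← cancel_epi ((α_ M K L).hom ≫ (koszulIso M (K ⊗ L)).hom ≫ (α_ K L M).hom)]
    nth_rw 2 [h]
    simp
    rfl
  symmetry := koszulHom_symm

end KoszulComplex

section MonoidalModel

open HomotopicalAlgebra

/-- A model category (with all small limits and colimits and with functorial factorizations)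
which is also a symmetric monoidal category is a symmetric monoidal model category if the monoidal
structure is closed, if the tensor product is a Quillen bifunctor, and if tensoring a
cofibrant replacement of the unit with a cofibrant object gives a weak equivalence. -/
structure IsSymmetricMonoidalModelCategory (C : Type u) [Category.{v} C] [MonoidalCategory C]
    [SymmetricCategory C] [ModelCategory C] : Prop where
  hasLimits : HasLimits C
  hasColimits : HasColimits C
  functorialFactorization_cof_trivFib :
    (cofibrations C).HasFunctorialFactorization (trivialFibrations C)
  functorialFactorization_trivCof_fib :
    (trivialCofibrations C).HasFunctorialFactorization (fibrations C)
  closed : Nonempty (MonoidalClosed C)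
  /-- the pushout product of two cofibrations is a cofibration -/
  pushoutProduct_cofibration {T U V W : C} (f : T ⟶ U) (g : V ⟶ W)
    (hf : Cofibration f) (hg : Cofibration g) :
    Cofibration ((Arrow.pushoutProduct.obj (Arrow.mk f)).obj (Arrow.mk g)).hom
  /-- it is trivial if one of the two cofibrations is trivial -/
  pushoutProduct_weakEquivalence {T U V W : C} (f : T ⟶ U) (g : V ⟶ W)
    (hf : Cofibration f) (hg : Cofibration g) (h : WeakEquivalence f ∨ WeakEquivalence g) :
    WeakEquivalence ((Arrow.pushoutProduct.obj (Arrow.mk f)).obj (Arrow.mk g)).hom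
  /-- the unit axiom -/
  unit_weakEquivalence {Q : C} (q : Q ⟶ 𝟙_ C) (hQ : IsCofibrant Q)
    (hq : Fibration q) (hq' : WeakEquivalence q) (X : C) (hX : IsCofibrant X) :
    WeakEquivalence (q ▷ X)

end MonoidalModel

section DG

variable (k : Type v) (O : Type u) [Field k] [CommRing O] [Algebra k O]

/-- Non-negatively graded chain complexes of `D`-modules. -/
abbrev DGDM := ChainComplex (DModCat k O) ℕ

/-- The quasi-isomorphisms. -/
def quasiIsos : MorphismProperty (DGDM k O) := fun _ _ f => QuasiIso f

/-- The chain maps that are surjective in all positive degrees. -/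
def projFibrations : MorphismProperty (DGDM k O) := fun _ _ f => ∀ n, 0 < n → Epi (f.f n)

/-- The injective chain maps whose cokernel is projective over `D` in each degree. -/
def projCofibrations : MorphismProperty (DGDM k O) :=
  fun _ _ f => ∀ n, Mono (f.f n) ∧ Projective (cokernel (f.f n))

variable [CharZero k] [Algebra.Smooth k O]

instance : MonoidalCategory (DGDM k O) := chainMonoidal

instance : SymmetricCategory (DGDM k O) := chainSymmetric

end DG

end DMod

end

open CategoryTheory Limits MonoidalCategory HomotopicalAlgebra DMod

/-!
A map of chain complexes in non-negative degrees is injective with degreewise projective cokernel if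
and only if in each degree it has the left lifting property against all epimorphisms, and it is a
trivial fibration if and only if all its matching maps `X (n + 1) ⟶ Y (n + 1) ×_{Z n Y} Z n X` are
epimorphisms. Lifting problems are therefore solved one degree at a time, and the factorizations
come from the small object argument for sphere-to-disk inclusions on a projective separator.

Pushout products of cofibrations are cofibrations as soon as projectives are closed under `⊗`. A
trivial cofibration is a retract of the inclusion of a direct summand with contractible complement,
so tensoring with any complex preserves it. Tensoring with a complex `M` of flat objects preserves
acyclicity: an acyclic complex is covered by a sum of disks, hence by a contractible complex, and
the long exact sequence shifts degrees down to `0`.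

For `D`-modules two facts remain. The algebra `D` is projective over `O`: the symbol of an operator
of order `n + 1` is recovered, up to the factor `n + 1`, from its commutators with functions by
Euler's identity, so in characteristic `0` each graded piece of the order filtration is a direct
summand of a sum of copies of the preceding one. Hence projective `D`-modules are projective, and
in particular flat, over `O`. Moreover `Hom_O (Q, N)` carries a `D`-module structure that makes it
right adjoint to `- ⊗ Q`; for projective `Q` it preserves epimorphisms in `N`, so `P ⊗ Q` is
projective whenever `P` and `Q` are.
-/

noncomputable section

namespace DMod

section DegreewiseLifting

variable {C : Type u} [Category.{v} C] [Abelian C]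

/-- A splitting of the short exact sequence defined by a monomorphism with projective cokernel. -/
def cokernelSplitting {A B : C} (i : A ⟶ B) [Mono i] [Projective (cokernel i)] :
    (ShortComplex.mk i (cokernel.π i) (cokernel.condition i)).Splitting :=
  have : Projective (ShortComplex.mk i (cokernel.π i) (cokernel.condition i)).X₃ :=
    inferInstanceAs (Projective (cokernel i))
  ShortComplex.ShortExact.splittingOfProjective
    { exact := ShortComplex.exact_cokernel i, mono_f := ‹Mono i› }

open ZeroObject in
theorem llp_epimorphisms_iff {A B : C} (i : A ⟶ B) :
    (MorphismProperty.epimorphisms C).llp i ↔ Mono i ∧ Projective (cokernel i) := by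
  constructor
  · intro h
    have mono_i : Mono i := by
      have := h (0 : A ⟶ (0 : C)) ((isZero_zero C).epi _)
      have sq : CommSq (𝟙 A) i (0 : A ⟶ (0 : C)) 0 := ⟨by simp⟩
      exact mono_of_mono_fac sq.fac_left
    refine ⟨mono_i, ⟨fun {E X} f e he ↦ ?_⟩⟩
    have := h e he
    have sq : CommSq (0 : A ⟶ E) i e (cokernel.π i ≫ f) := ⟨by simp⟩
    refine ⟨cokernel.desc i sq.lift sq.fac_left, ?_⟩
    rw [← cancel_epi (cokernel.π i), cokernel.π_desc_assoc, sq.fac_right]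
  · rintro ⟨_, _⟩ X Y p (_ : Epi p)
    let σ := cokernelSplitting i
    have i_r : i ≫ σ.r = 𝟙 A := σ.f_r
    have r_i : σ.r ≫ i + cokernel.π i ≫ σ.s = 𝟙 B := σ.id
    refine ⟨fun {t b} sq ↦ ⟨⟨⟨σ.r ≫ t + cokernel.π i ≫
      Projective.factorThru (P := cokernel i) (σ.s ≫ b) p, ?_, ?_⟩⟩⟩⟩
    · rw [Preadditive.comp_add, reassoc_of% i_r, cokernel.condition_assoc, zero_comp, add_zero]
    · rw [Preadditive.add_comp, Category.assoc, Category.assoc, Projective.factorThru_comp, sq.w,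
        ← Category.assoc, ← Category.assoc, ← Preadditive.add_comp, r_i, Category.id_comp]

theorem epi_iff_forall_exists_lift {G : C} (hG : IsSeparator G) [Projective G] {X Y : C}
    (f : X ⟶ Y) : Epi f ↔ ∀ y : G ⟶ Y, ∃ x, x ≫ f = y := by
  refine ⟨fun _ y ↦ ⟨_, Projective.factorThru_comp y f⟩, fun h ↦ ?_⟩
  refine Preadditive.epi_of_cokernel_zero (hG.def _ _ fun y ↦ ?_)
  obtain ⟨x, rfl⟩ := h y
  simp

end DegreewiseLifting

section Disks

variable {C : Type u} [Category.{v} C] [Abelian C]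

theorem acyclic_of_homotopy_id_zero {ι : Type*} {c : ComplexShape ι} {K : HomologicalComplex C c}
    (h : Homotopy (𝟙 K) 0) : K.Acyclic := fun n ↦ by
  rw [HomologicalComplex.exactAt_iff_isZero_homology, IsZero.iff_id_eq_zero,
    ← HomologicalComplex.homologyMap_id, h.homologyMap_eq, HomologicalComplex.homologyMap_zero]

/-- The objects of the complex `disks G`. -/
def disksX (G : ℕ → C) : ℕ → C
  | 0 => G 0
  | n + 1 => G (n + 1) ⊞ G n

/-- The differential of the complex `disks G`. -/
def disksD (G : ℕ → C) : ∀ n, disksX G (n + 1) ⟶ disksX G n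
  | 0 => biprod.snd
  | _ + 1 => biprod.snd ≫ biprod.inl

/-- The direct sum over `n` of the complexes `𝟙 : G n ⟶ G n` concentrated in degrees `n + 1`
and `n`. -/
def disks (G : ℕ → C) : ChainComplex C ℕ :=
  ChainComplex.of (disksX G) (disksD G) fun n ↦ by
    cases n <;> (simp [disksX, disksD]; rfl)

namespace disks

section

variable (G : ℕ → C)

/-- The projection of `disks G` onto the lower copy of `G n`. -/
def fst : ∀ n, (disks G).X n ⟶ G n
  | 0 => 𝟙 (G 0)
  | n + 1 => (biprod.fst : G (n + 1) ⊞ G n ⟶ _)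

/-- The projection of `disks G` onto the upper copy of `G n`. -/
def snd (n : ℕ) : (disks G).X (n + 1) ⟶ G n := (biprod.snd : G (n + 1) ⊞ G n ⟶ _)

/-- The inclusion of the lower copy of `G n` in `disks G`. -/
def inl : ∀ n, G n ⟶ (disks G).X n
  | 0 => 𝟙 (G 0)
  | n + 1 => (biprod.inl : _ ⟶ G (n + 1) ⊞ G n)

/-- The inclusion of the upper copy of `G n` in `disks G`. -/
def inr (n : ℕ) : G n ⟶ (disks G).X (n + 1) := (biprod.inr : _ ⟶ G (n + 1) ⊞ G n)

theorem inl_fst : ∀ n, inl G n ≫ fst G n = 𝟙 _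
  | 0 => Category.comp_id _
  | _ + 1 => biprod.inl_fst

theorem inr_snd (n : ℕ) : inr G n ≫ snd G n = 𝟙 _ := biprod.inr_snd

theorem inl_snd (n : ℕ) : inl G (n + 1) ≫ snd G n = 0 := biprod.inl_snd

theorem inr_fst (n : ℕ) : inr G n ≫ fst G (n + 1) = 0 := biprod.inr_fst

theorem fst_inl_zero : fst G 0 ≫ inl G 0 = 𝟙 ((disks G).X 0) := Category.comp_id _

theorem fst_inl_add_snd_inr (n : ℕ) :
    fst G (n + 1) ≫ inl G (n + 1) + snd G n ≫ inr G n = 𝟙 _ := biprod.total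

theorem d_eq (n : ℕ) : (disks G).d (n + 1) n = snd G n ≫ inl G n := by
  refine (ChainComplex.of_d (disksX G) (disksD G) n).trans ?_
  cases n with
  | zero => exact (Category.comp_id _).symm
  | succ n => rfl

end

variable {G G' : ℕ → C}

/-- The components of the contraction of `disks G`. -/
def contraction (i j : ℕ) (h : (ComplexShape.down ℕ).Rel j i) : (disks G).X i ⟶ (disks G).X j :=
  fst G i ≫ inr G i ≫ eqToHom (congrArg (disks G).X h)

theorem contraction_succ (i : ℕ) (h : (ComplexShape.down ℕ).Rel (i + 1) i) :
    contraction (G := G) i (i + 1) h = fst G i ≫ inr G i := by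
  simp [contraction]

theorem nullHomotopicMap'_contraction :
    Homotopy.nullHomotopicMap' (contraction (G := G)) = 𝟙 (disks G) := by
  ext n
  cases n with
  | zero =>
    rw [Homotopy.nullHomotopicMap'_f_of_not_rel_left (k₁ := 1)
      (show (ComplexShape.down ℕ).Rel 1 0 from rfl) (by simp), contraction_succ, d_eq,
      Category.assoc, reassoc_of% inr_snd, fst_inl_zero, HomologicalComplex.id_f]
  | succ n =>
    rw [Homotopy.nullHomotopicMap'_f (k₂ := n + 2) (k₀ := n)
      (show (ComplexShape.down ℕ).Rel (n + 2) (n + 1) from rfl)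
      (show (ComplexShape.down ℕ).Rel (n + 1) n from rfl), contraction_succ, contraction_succ,
      d_eq, d_eq, Category.assoc, Category.assoc, reassoc_of% inr_snd, reassoc_of% inl_fst]
    exact (add_comm _ _).trans (fst_inl_add_snd_inr G n)

/-- The contraction of `disks G`. -/
def homotopyIdZero (G : ℕ → C) : Homotopy (𝟙 (disks G)) 0 :=
  (Homotopy.ofEq nullHomotopicMap'_contraction.symm).trans (Homotopy.nullHomotopy' contraction)

theorem acyclic (G : ℕ → C) : (disks G).Acyclic :=
  acyclic_of_homotopy_id_zero (homotopyIdZero G)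

theorem f_snd {X : ChainComplex C ℕ} (f : X ⟶ disks G) (n : ℕ) :
    f.f (n + 1) ≫ snd G n = X.d (n + 1) n ≫ f.f n ≫ fst G n := by
  rw [← f.comm_assoc, d_eq, Category.assoc, inl_fst, Category.comp_id]

theorem inl_f {L : ChainComplex C ℕ} (f : disks G ⟶ L) (n : ℕ) :
    inl G n ≫ f.f n = inr G n ≫ f.f (n + 1) ≫ L.d (n + 1) n := by
  rw [f.comm, d_eq, Category.assoc, reassoc_of% inr_snd]

theorem hom_ext_to {X : ChainComplex C ℕ} {f g : X ⟶ disks G}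
    (h : ∀ n, f.f n ≫ fst G n = g.f n ≫ fst G n) : f = g := by
  ext n
  cases n with
  | zero => rw [← Category.comp_id (f.f 0), ← fst_inl_zero, reassoc_of% h, fst_inl_zero,
      Category.comp_id]
  | succ n => exact biprod.hom_ext _ _ (h (n + 1)) ((f_snd f n).trans (by rw [h, ← f_snd]; rfl))

theorem hom_ext_from {L : ChainComplex C ℕ} {f g : disks G ⟶ L}
    (h : ∀ n, inr G n ≫ f.f (n + 1) = inr G n ≫ g.f (n + 1)) : f = g := by
  have h_inl (n : ℕ) : inl G n ≫ f.f n = inl G n ≫ g.f n := by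
    rw [inl_f, inl_f, reassoc_of% h]
  ext n
  cases n with
  | zero => rw [← Category.id_comp (f.f 0), ← fst_inl_zero, Category.assoc, h_inl,
      ← Category.assoc, fst_inl_zero, Category.id_comp]
  | succ n => exact biprod.hom_ext' _ _ (h_inl (n + 1)) (h n)

/-- The chain map to `disks G` given by a family of maps to the lower copies of the `G n`. -/
def lift {X : ChainComplex C ℕ} (φ : ∀ n, X.X n ⟶ G n) : X ⟶ disks G where
  f
    | 0 => φ 0 ≫ inl G 0
    | n + 1 => φ (n + 1) ≫ inl G (n + 1) + X.d (n + 1) n ≫ φ n ≫ inr G n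
  comm' := by
    rintro _ n rfl
    cases n <;> simp [d_eq, reassoc_of% inl_snd, reassoc_of% inr_snd]

theorem lift_f_fst {X : ChainComplex C ℕ} (φ : ∀ n, X.X n ⟶ G n) (n : ℕ) :
    (lift φ).f n ≫ fst G n = φ n := by
  cases n <;> simp [lift, inl_fst, inr_fst]

/-- The chain map from `disks G` given by a family of maps from the upper copies of the `G n`. -/
def desc {L : ChainComplex C ℕ} (e : ∀ n, G n ⟶ L.X (n + 1)) : disks G ⟶ L where
  f
    | 0 => fst G 0 ≫ e 0 ≫ L.d 1 0
    | n + 1 => fst G (n + 1) ≫ e (n + 1) ≫ L.d (n + 1 + 1) (n + 1) + snd G n ≫ e n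
  comm' := by
    rintro _ n rfl
    cases n <;> simp [d_eq, reassoc_of% inl_fst, reassoc_of% inl_snd]

theorem inr_desc_f {L : ChainComplex C ℕ} (e : ∀ n, G n ⟶ L.X (n + 1)) (n : ℕ) :
    inr G n ≫ (desc e).f (n + 1) = e n := by
  simp [desc, reassoc_of% inr_snd, reassoc_of% inr_fst]

/-- The chain map `disks G ⟶ disks G'` induced by a family of maps `G n ⟶ G' n`. -/
def map (g : ∀ n, G n ⟶ G' n) : disks G ⟶ disks G' := lift fun n ↦ fst G n ≫ g n

theorem map_f_fst (g : ∀ n, G n ⟶ G' n) (n : ℕ) :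
    (map g).f n ≫ fst G' n = fst G n ≫ g n := lift_f_fst _ n

theorem map_f_zero (g : ∀ n, G n ⟶ G' n) : (map g).f 0 = g 0 :=
  (Category.comp_id _).trans (Category.id_comp _)

theorem map_f_succ (g : ∀ n, G n ⟶ G' n) (n : ℕ) :
    (map g).f (n + 1) = biprod.map (g (n + 1)) (g n) :=
  biprod.hom_ext _ _ ((map_f_fst g (n + 1)).trans (biprod.map_fst _ _).symm)
    ((f_snd (map g) n).trans (by
      rw [map_f_fst, d_eq, Category.assoc, reassoc_of% inl_fst]
      exact (biprod.map_snd _ _).symm))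

theorem epi_map_f (g : ∀ n, G n ⟶ G' n) [∀ n, Epi (g n)] (n : ℕ) : Epi ((map g).f n) := by
  cases n with
  | zero => exact map_f_zero g ▸ inferInstanceAs (Epi (g 0))
  | succ n => exact map_f_succ g n ▸ inferInstanceAs (Epi (biprod.map (g (n + 1)) (g n)))

theorem exists_lift [∀ n, Projective (G n)] {X Y : ChainComplex C ℕ} (p : X ⟶ Y)
    [∀ n, Epi (p.f (n + 1))] (ψ : disks G ⟶ Y) : ∃ φ, φ ≫ p = ψ :=
  ⟨desc fun n ↦ Projective.factorThru (inr G n ≫ ψ.f (n + 1)) (p.f (n + 1)), hom_ext_from fun n ↦ by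
    rw [HomologicalComplex.comp_f, reassoc_of% inr_desc_f, Projective.factorThru_comp]⟩

end disks

end Disks

section TrivialFibrations

open HomologicalComplex

variable {C : Type u} [Category.{v} C] [Abelian C] {X Y : ChainComplex C ℕ} (p : X ⟶ Y)

theorem toCycles_cyclesMap (i j : ℕ) :
    X.toCycles i j ≫ cyclesMap p j = p.f i ≫ Y.toCycles i j := by
  simp [← cancel_mono (Y.iCycles j)]

/-- The map from `X.X (n + 1)` to the object `Y.X (n + 1) ×_{Z_n Y} Z_n X` of matching pairs; it is
an epimorphism iff `p` has the right lifting property with respect to the inclusions of the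
`n`-sphere in the `(n + 1)`-disk. -/
def matchingMap (n : ℕ) : X.X (n + 1) ⟶ pullback (Y.toCycles (n + 1) n) (cyclesMap p n) :=
  pullback.lift (p.f (n + 1)) (X.toCycles (n + 1) n) (toCycles_cyclesMap p _ _).symm

theorem matchingMap_fst (n : ℕ) : matchingMap p n ≫ pullback.fst _ _ = p.f (n + 1) :=
  pullback.lift_fst _ _ _

theorem matchingMap_snd (n : ℕ) : matchingMap p n ≫ pullback.snd _ _ = X.toCycles (n + 1) n :=
  pullback.lift_snd _ _ _

theorem epi_cyclesMap_zero_iff : Epi (cyclesMap p 0) ↔ Epi (p.f 0) := by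
  have := X.isIso_iCycles 0 _ rfl (by simp)
  have := Y.isIso_iCycles 0 _ rfl (by simp)
  rw [← epi_comp_iff_of_epi (X.iCycles 0) (p.f 0), ← cyclesMap_i, epi_comp_iff_of_isIso]

theorem epi_cyclesMap_of_quasiIso [QuasiIso p] (n : ℕ) [Epi (p.f (n + 1))] :
    Epi (cyclesMap p n) := by
  rw [epi_iff_surjective_up_to_refinements]
  intro A y
  obtain ⟨A₁, π₁, _, x, hx⟩ := surjective_up_to_refinements_of_epi (X.homologyπ n)
    (y ≫ Y.homologyπ n ≫ inv (homologyMap p n))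
  have hxy : (π₁ ≫ y) ≫ Y.homologyπ n = (x ≫ cyclesMap p n) ≫ Y.homologyπ n := by
    rw [Category.assoc x, ← homologyπ_naturality]
    simpa using hx =≫ homologyMap p n
  obtain ⟨A₂, π₂, _, y', hy'⟩ :=
    (comp_homologyπ_eq_iff_up_to_refinements _ (n + 1) n (by simp) _ _).1 hxy
  obtain ⟨A₃, π₃, _, x', hx'⟩ := surjective_up_to_refinements_of_epi (p.f (n + 1)) y'
  refine ⟨A₃, π₃ ≫ π₂ ≫ π₁, inferInstance, π₃ ≫ π₂ ≫ x + x' ≫ X.toCycles (n + 1) n, ?_⟩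
  simp only [Category.assoc, Preadditive.add_comp, hy', Preadditive.comp_add,
    toCycles_cyclesMap, reassoc_of% hx']

theorem epi_matchingMap_of_quasiIso [QuasiIso p] (n : ℕ) [Epi (cyclesMap p (n + 1))] :
    Epi (matchingMap p n) := by
  rw [epi_iff_surjective_up_to_refinements]
  intro A a
  set y := a ≫ pullback.fst _ _
  set z := a ≫ pullback.snd _ _
  have hyz : y ≫ Y.toCycles (n + 1) n = z ≫ cyclesMap p n := by simp [y, z, pullback.condition]
  have hz : z ≫ X.homologyπ n = 0 := by
    rw [← cancel_mono (homologyMap p n), zero_comp, Category.assoc, homologyπ_naturality,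
      ← Category.assoc, ← hyz, Category.assoc, toCycles_comp_homologyπ, comp_zero]
  obtain ⟨A₁, π₁, _, x, hx⟩ :=
    (comp_homologyπ_eq_zero_iff_up_to_refinements _ (n + 1) n (by simp) _).1 hz
  have hd : (π₁ ≫ y - x ≫ p.f (n + 1)) ≫ Y.d (n + 1) n = 0 := by
    rw [← Y.toCycles_i (n + 1) n, ← Category.assoc, Preadditive.sub_comp]
    simp [hyz, reassoc_of% hx]
  obtain ⟨A₂, π₂, _, x', hx'⟩ := surjective_up_to_refinements_of_epi (cyclesMap p (n + 1))
    (Y.liftCycles _ n (by simp) hd)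
  replace hx' := hx' =≫ Y.iCycles (n + 1)
  simp only [Category.assoc, liftCycles_i, cyclesMap_i] at hx'
  refine ⟨A₂, π₂ ≫ π₁, inferInstance, π₂ ≫ x + x' ≫ X.iCycles (n + 1), pullback.hom_ext ?_ ?_⟩
  · simp [matchingMap_fst, ← hx', y]
  · rw [← cancel_mono (X.iCycles n)]
    simp [matchingMap_snd, reassoc_of% (show π₁ ≫ a ≫ pullback.snd _ _ = _ from hx)]

variable {p} in
theorem exists_lift_of_epi_matchingMap {n : ℕ} [Epi (matchingMap p n)] {A : C}
    (y : A ⟶ Y.X (n + 1)) (z : A ⟶ X.cycles n)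
    (h : y ≫ Y.toCycles (n + 1) n = z ≫ cyclesMap p n) :
    ∃ (A' : C) (π : A' ⟶ A) (_ : Epi π) (x : A' ⟶ X.X (n + 1)),
      x ≫ p.f (n + 1) = π ≫ y ∧ x ≫ X.toCycles (n + 1) n = π ≫ z := by
  obtain ⟨A', π, hπ, x, hx⟩ := surjective_up_to_refinements_of_epi (matchingMap p n)
    (pullback.lift y z h)
  refine ⟨A', π, hπ, x, ?_, ?_⟩
  · rw [← matchingMap_fst, ← Category.assoc, ← hx, Category.assoc]
    exact π ≫= pullback.lift_fst _ _ _
  · rw [← matchingMap_snd p, ← Category.assoc, ← hx, Category.assoc]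
    exact π ≫= pullback.lift_snd _ _ _

variable {p} in
theorem exists_lift_of_llp_epimorphisms {A B : C} {i : A ⟶ B}
    (hi : (MorphismProperty.epimorphisms C).llp i) {n : ℕ} [Epi (matchingMap p n)]
    {t : A ⟶ X.X (n + 1)} {b : B ⟶ Y.X (n + 1)} (w : t ≫ p.f (n + 1) = i ≫ b)
    (z : B ⟶ X.cycles n) (i_z : i ≫ z = t ≫ X.toCycles (n + 1) n)
    (z_p : z ≫ cyclesMap p n = b ≫ Y.toCycles (n + 1) n) :
    ∃ l, i ≫ l = t ∧ l ≫ p.f (n + 1) = b ∧ l ≫ X.toCycles (n + 1) n = z := by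
  let m := pullback.lift b z z_p.symm
  have m_fst : m ≫ pullback.fst _ _ = b := pullback.lift_fst _ _ _
  have m_snd : m ≫ pullback.snd _ _ = z := pullback.lift_snd _ _ _
  have := hi (matchingMap p n) ‹_›
  have sq : CommSq t i (matchingMap p n) m := ⟨pullback.hom_ext
    (by rw [Category.assoc, Category.assoc, matchingMap_fst, m_fst, w])
    (by rw [Category.assoc, Category.assoc, matchingMap_snd, m_snd, i_z])⟩
  refine ⟨sq.lift, sq.fac_left, ?_, ?_⟩
  · rw [← matchingMap_fst, ← Category.assoc, sq.fac_right, m_fst]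
  · rw [← matchingMap_snd p, ← Category.assoc, sq.fac_right, m_snd]

section

variable [Epi (p.f 0)] [∀ n, Epi (matchingMap p n)]

theorem epi_cyclesMap_of_epi_matchingMap (n : ℕ) : Epi (cyclesMap p n) := by
  cases n with
  | zero => exact (epi_cyclesMap_zero_iff p).2 ‹_›
  | succ n =>
    rw [epi_iff_surjective_up_to_refinements]
    intro A y
    obtain ⟨A', π, hπ, x, hx, hx'⟩ := exists_lift_of_epi_matchingMap (p := p)
      (y ≫ Y.iCycles (n + 1)) (0 : A ⟶ X.cycles n) (by simp [← cancel_mono (Y.iCycles n)])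
    refine ⟨A', π, hπ, X.liftCycles x n (by simp) ?_, ?_⟩
    · rw [← X.toCycles_i, reassoc_of% hx', zero_comp, comp_zero]
    · simp [← cancel_mono (Y.iCycles (n + 1)), hx]

theorem epi_f_of_epi_matchingMap (n : ℕ) : Epi (p.f n) := by
  cases n with
  | zero => infer_instance
  | succ n =>
    have := epi_cyclesMap_of_epi_matchingMap p n
    rw [← matchingMap_fst]
    infer_instance

theorem quasiIso_of_epi_matchingMap : QuasiIso p where
  quasiIsoAt n := by
    rw [quasiIsoAt_iff_isIso_homologyMap]
    have : Epi (homologyMap p n) := by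
      have := epi_cyclesMap_of_epi_matchingMap p n
      exact epi_of_epi_fac (homologyπ_naturality p n)
    have : Mono (homologyMap p n) := by
      refine Preadditive.mono_of_cancel_zero _ fun {A} a ha ↦ ?_
      obtain ⟨A₁, π₁, _, z, hz⟩ := surjective_up_to_refinements_of_epi (X.homologyπ n) a
      have hpz : (z ≫ cyclesMap p n) ≫ Y.homologyπ n = 0 := by
        rw [Category.assoc, ← homologyπ_naturality, ← reassoc_of% hz, ha, comp_zero]
      obtain ⟨A₂, π₂, _, y, hy⟩ :=
        (comp_homologyπ_eq_zero_iff_up_to_refinements _ (n + 1) n (by simp) _).1 hpz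
      obtain ⟨A₃, π₃, _, x, -, hx⟩ := exists_lift_of_epi_matchingMap y (π₂ ≫ z)
        (by rw [← hy, Category.assoc])
      rw [← cancel_epi (π₃ ≫ π₂ ≫ π₁), comp_zero, Category.assoc, Category.assoc, hz,
        ← Category.assoc π₂, ← Category.assoc π₃, ← hx, Category.assoc, toCycles_comp_homologyπ,
        comp_zero]
    exact isIso_of_mono_of_epi _

variable {p} in
theorem hasLiftingProperty_of_epi_matchingMap {A B : ChainComplex C ℕ} (i : A ⟶ B)
    (hi : ∀ n, (MorphismProperty.epimorphisms C).llp (i.f n)) : HasLiftingProperty i p where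
  sq_hasLift {t b} sq := by
    have sq_f (n : ℕ) : t.f n ≫ p.f n = i.f n ≫ b.f n := congr_hom sq.w n
    let PartialLift (n : ℕ) := { h : B.X n ⟶ X.X n //
      i.f n ≫ h = t.f n ∧ h ≫ p.f n = b.f n ∧ ∀ j, B.d (n + 1) n ≫ h ≫ X.d n j = 0 }
    have start : Nonempty (PartialLift 0) := by
      have := hi 0 (p.f 0) ‹_›
      have sq₀ : CommSq (t.f 0) (i.f 0) (p.f 0) (b.f 0) := ⟨sq_f 0⟩
      exact ⟨sq₀.lift, sq₀.fac_left, sq₀.fac_right, by simp⟩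
    have extend (n : ℕ) (h : PartialLift n) :
        ∃ h' : PartialLift (n + 1), h'.1 ≫ X.d (n + 1) n = B.d (n + 1) n ≫ h.1 := by
      obtain ⟨h, i_h, h_p, d_h_d⟩ := h
      obtain ⟨l, i_l, l_p, l_toCycles⟩ := exists_lift_of_llp_epimorphisms (hi (n + 1))
        (sq_f (n + 1)) (X.liftCycles (B.d (n + 1) n ≫ h) _ rfl (by rw [Category.assoc, d_h_d]))
        (by simp [← cancel_mono (X.iCycles n), i_h])
        (by simp [← cancel_mono (Y.iCycles n), h_p])
      have l_d : l ≫ X.d (n + 1) n = B.d (n + 1) n ≫ h := by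
        rw [← X.toCycles_i, reassoc_of% l_toCycles, liftCycles_i]
      refine ⟨⟨l, i_l, l_p, fun j ↦ ?_⟩, l_d⟩
      obtain rfl | hj := eq_or_ne n j
      · rw [l_d, B.d_comp_d_assoc, zero_comp]
      · rw [X.shape _ _ (by simpa using hj.symm), comp_zero, comp_zero]
    choose next next_d using extend
    let l (n : ℕ) : PartialLift n := Nat.rec start.some next n
    refine ⟨⟨⟨⟨fun n ↦ (l n).1, ?_⟩, ?_, ?_⟩⟩⟩
    · rintro _ n rfl
      exact next_d n (l n)
    · ext n
      exact (l n).2.1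
    · ext n
      exact (l n).2.2.1

end

theorem llp_epimorphisms_of_llp_epi_quasiIso {A B : ChainComplex C ℕ} (i : A ⟶ B)
    (hi : ∀ {X Y : ChainComplex C ℕ} (p : X ⟶ Y) [∀ n, Epi (p.f n)] [QuasiIso p],
      HasLiftingProperty i p) (n : ℕ) :
    (MorphismProperty.epimorphisms C).llp (i.f n) := by
  intro E F e (_ : Epi e)
  let g : ∀ _ : ℕ, E ⟶ F := fun _ ↦ e
  have (n : ℕ) : Epi ((disks.map g).f n) := disks.epi_map_f g n
  have : QuasiIso (disks.map g) :=
    ⟨fun n ↦ (quasiIsoAt_iff_exactAt _ _ (disks.acyclic _ n)).2 (disks.acyclic _ n)⟩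
  have := hi (disks.map g)
  refine ⟨fun {t b} sq ↦ ?_⟩
  have sq' : CommSq (disks.lift (Pi.single n t)) i (disks.map g) (disks.lift (Pi.single n b)) :=
    ⟨disks.hom_ext_to fun m ↦ by
      rw [comp_f, comp_f, Category.assoc, Category.assoc, disks.map_f_fst, disks.lift_f_fst,
        reassoc_of% disks.lift_f_fst]
      obtain rfl | h := eq_or_ne m n
      · simp [g, sq.w]
      · simp [h]⟩
  refine ⟨⟨⟨sq'.lift.f n ≫ disks.fst _ n, ?_, ?_⟩⟩⟩
  · rw [← Category.assoc, ← comp_f, sq'.fac_left, disks.lift_f_fst, Pi.single_eq_same]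
  · rw [Category.assoc, ← disks.map_f_fst g, ← Category.assoc, ← comp_f, sq'.fac_right,
      disks.lift_f_fst, Pi.single_eq_same]

end TrivialFibrations

section FibrationsAndCofibrations

open MorphismProperty HomologicalComplex

variable (C : Type u) [Category.{v} C] [Abelian C]

/-- The fibrations of the projective model structure on chain complexes. -/
def chainFibrations : MorphismProperty (ChainComplex C ℕ) :=
  fun _ _ f ↦ ∀ n, 0 < n → Epi (f.f n)

/-- The cofibrations of the projective model structure on chain complexes. -/
def chainCofibrations : MorphismProperty (ChainComplex C ℕ) :=
  fun _ _ f ↦ ∀ n, Mono (f.f n) ∧ Projective (cokernel (f.f n))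

/-- The weak equivalences of the projective model structure on chain complexes. -/
abbrev chainQuasiIsos : MorphismProperty (ChainComplex C ℕ) := quasiIso C _

variable {C}

theorem chainCofibrations_iff {A B : ChainComplex C ℕ} (i : A ⟶ B) :
    chainCofibrations C i ↔ ∀ n, (epimorphisms C).llp (i.f n) :=
  forall_congr' fun _ ↦ (llp_epimorphisms_iff _).symm

theorem chainFibrations_inf_quasiIsos_iff {X Y : ChainComplex C ℕ} (p : X ⟶ Y) :
    (chainFibrations C ⊓ chainQuasiIsos C) p ↔ Epi (p.f 0) ∧ ∀ n, Epi (matchingMap p n) := by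
  constructor
  · rintro ⟨hp, _ : QuasiIso p⟩
    have (n : ℕ) : Epi (p.f (n + 1)) := hp _ n.succ_pos
    have (n : ℕ) : Epi (cyclesMap p n) := epi_cyclesMap_of_quasiIso p n
    exact ⟨(epi_cyclesMap_zero_iff p).1 (this 0), fun n ↦ epi_matchingMap_of_quasiIso p n⟩
  · rintro ⟨_, _⟩
    exact ⟨fun n _ ↦ epi_f_of_epi_matchingMap p n, quasiIso_of_epi_matchingMap p⟩

theorem llp_chainFibrations_inf_quasiIsos :
    (chainFibrations C ⊓ chainQuasiIsos C).llp = chainCofibrations C := by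
  ext A B i
  rw [chainCofibrations_iff]
  refine ⟨fun h ↦ llp_epimorphisms_of_llp_epi_quasiIso i
    fun p _ hp ↦ h p ⟨fun n _ ↦ inferInstance, hp⟩, fun h X Y p hp ↦ ?_⟩
  obtain ⟨_, _⟩ := (chainFibrations_inf_quasiIsos_iff p).1 hp
  exact hasLiftingProperty_of_epi_matchingMap i h

theorem llp_chainFibrations_biprod_inl (T : ChainComplex C ℕ) (G : ℕ → C)
    [∀ n, Projective (G n)] :
    (chainFibrations C).llp (biprod.inl : T ⟶ T ⊞ disks G) := by
  intro X Y p hp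
  have (n : ℕ) : Epi (p.f (n + 1)) := hp _ n.succ_pos
  refine ⟨fun {t b} sq ↦ ?_⟩
  obtain ⟨φ, hφ⟩ := disks.exists_lift p (biprod.inr ≫ b)
  exact ⟨⟨⟨biprod.desc t φ, by simp, biprod.hom_ext' _ _ (by simp [sq.w]) (by simp [hφ])⟩⟩⟩

/-- The inclusion of `T` in its direct sum with a contractible complex. -/
def homotopyEquivBiprodInl (T E : ChainComplex C ℕ) (h : Homotopy (𝟙 E) 0) :
    HomotopyEquiv T (T ⊞ E) where
  hom := biprod.inl
  inv := biprod.fst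
  homotopyHomInvId := .ofEq (by simp)
  homotopyInvHomId := .trans (.ofEq (by simp)) <| .trans
    ((Homotopy.refl (biprod.fst ≫ biprod.inl)).add
      ((h.symm.compLeft biprod.snd).compRight biprod.inr)) (.ofEq (by simp))

theorem quasiIso_biprod_inl (T E : ChainComplex C ℕ) (h : Homotopy (𝟙 E) 0) :
    QuasiIso (biprod.inl : T ⟶ T ⊞ E) :=
  inferInstanceAs (QuasiIso (homotopyEquivBiprodInl T E h).hom)

section Projectives

variable [EnoughProjectives C]

/-- The sum of contractible disks on projective objects covering the terms of `L` in positive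
degrees. -/
def coveringDisks (L : ChainComplex C ℕ) : ChainComplex C ℕ :=
  disks fun n ↦ Projective.over (L.X (n + 1))

/-- The map from `coveringDisks L` to `L` induced by the covering maps. -/
def coveringDisksπ (L : ChainComplex C ℕ) : coveringDisks L ⟶ L :=
  disks.desc fun n ↦ Projective.π (L.X (n + 1))

instance (L : ChainComplex C ℕ) (n : ℕ) : Epi ((coveringDisksπ L).f (n + 1)) :=
  epi_of_epi_fac (disks.inr_desc_f (fun n ↦ Projective.π (L.X (n + 1))) n)

theorem chainFibrations_biprod_desc_coveringDisksπ {T L : ChainComplex C ℕ} (f : T ⟶ L) :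
    chainFibrations C (biprod.desc f (coveringDisksπ L)) := fun
  | n + 1, _ => epi_of_epi_fac (congr_hom (biprod.inr_desc f (coveringDisksπ L)) (n + 1))

theorem llp_chainFibrations :
    (chainFibrations C).llp = chainCofibrations C ⊓ chainQuasiIsos C := by
  ext A B i
  let j : A ⟶ A ⊞ coveringDisks B := biprod.inl
  let q := biprod.desc i (coveringDisksπ B)
  have j_q : j ≫ q = i := biprod.inl_desc _ _
  have : QuasiIso j := quasiIso_biprod_inl A _ (disks.homotopyIdZero _)
  have hq : chainFibrations C q := chainFibrations_biprod_desc_coveringDisksπ i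
  constructor
  · intro h
    refine ⟨?_, ?_⟩
    · rw [← llp_chainFibrations_inf_quasiIsos]
      exact fun _ _ p hp ↦ h p hp.1
    · have := h q hq
      exact quasiIso_of_retractArrow (RetractArrow.ofLeftLiftingProperty j_q)
  · rintro ⟨hi, hi' : QuasiIso i⟩
    have : QuasiIso q := by
      rw [← j_q] at hi'
      exact quasiIso_of_comp_left j q
    rw [← llp_chainFibrations_inf_quasiIsos] at hi
    have := hi q ⟨hq, this⟩
    exact of_retract (RetractArrow.ofLeftLiftingProperty j_q)
      (llp_chainFibrations_biprod_inl A _)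

end Projectives

end FibrationsAndCofibrations

section Generators

open MorphismProperty HomologicalComplex ZeroObject

variable {C : Type u} [Category.{v} C] [Abelian C] (G : C)

/-- The complex `𝟙 : G ⟶ G` concentrated in degrees `n + 1` and `n`. -/
abbrev disk (n : ℕ) : ChainComplex C ℕ :=
  double (𝟙 G) (show (ComplexShape.down ℕ).Rel (n + 1) n from rfl)

/-- The complex `G` concentrated in degree `n`. -/
abbrev sphere (n : ℕ) : ChainComplex C ℕ := (single C (.down ℕ) n).obj G

/-- The `n`-disk on `G` corepresents the `G`-points in degree `n + 1`. -/
def diskHom (n : ℕ) {X : ChainComplex C ℕ} : (disk G n ⟶ X) ≃ (G ⟶ X.X (n + 1)) :=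
  (evalCompCoyonedaCorepresentableByDoubleId _ (by simp) G).homEquiv

variable {G} in
theorem diskHom_comp {n : ℕ} {X Y : ChainComplex C ℕ} (φ : disk G n ⟶ X) (p : X ⟶ Y) :
    diskHom G n (φ ≫ p) = diskHom G n φ ≫ p.f (n + 1) :=
  (evalCompCoyonedaCorepresentableByDoubleId _ (by simp) G).homEquiv_comp p φ

/-- The `n`-sphere on `G` corepresents the `G`-points of the cycles in degree `n`. -/
def sphereHom (n : ℕ) {X : ChainComplex C ℕ} : (sphere G n ⟶ X) ≃ (G ⟶ X.cycles n) where
  toFun φ := X.liftCycles ((singleObjXSelf (.down ℕ) n G).inv ≫ φ.f n) _ rfl (by simp)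
  invFun z := mkHomFromSingle (z ≫ X.iCycles n) (by simp)
  left_inv φ := from_single_hom_ext (by simp)
  right_inv z := by simp [← cancel_mono (X.iCycles n)]

variable {G} in
theorem sphereHom_comp {n : ℕ} {X Y : ChainComplex C ℕ} (φ : sphere G n ⟶ X) (p : X ⟶ Y) :
    sphereHom G n (φ ≫ p) = sphereHom G n φ ≫ cyclesMap p n := by
  simp [sphereHom]

/-- The inclusion of the boundary of a disk. -/
def sphereToDisk (n : ℕ) : sphere G n ⟶ disk G n :=
  (sphereHom G n).symm (diskHom G n (𝟙 _) ≫ (disk G n).toCycles (n + 1) n)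

variable {G} in
theorem sphereHom_sphereToDisk_comp {n : ℕ} {X : ChainComplex C ℕ} (φ : disk G n ⟶ X) :
    sphereHom G n (sphereToDisk G n ≫ φ) = diskHom G n φ ≫ X.toCycles (n + 1) n := by
  rw [sphereHom_comp, sphereToDisk, Equiv.apply_symm_apply, Category.assoc, toCycles_cyclesMap,
    ← Category.assoc, ← diskHom_comp, Category.id_comp]

variable {X Y : ChainComplex C ℕ} (p : X ⟶ Y)

theorem hasLiftingProperty_zero_iff (D : ChainComplex C ℕ) :
    HasLiftingProperty (0 : 0 ⟶ D) p ↔ ∀ b : D ⟶ Y, ∃ l, l ≫ p = b := by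
  refine ⟨fun _ b ↦ ?_, fun h ↦ ⟨fun {_ b} _ ↦ ?_⟩⟩
  · have sq : CommSq (0 : 0 ⟶ X) (0 : 0 ⟶ D) p b := ⟨by simp⟩
    exact ⟨sq.lift, sq.fac_right⟩
  · obtain ⟨l, hl⟩ := h b
    exact ⟨⟨⟨l, (isZero_zero _).eq_of_src _ _, hl⟩⟩⟩

theorem hasLiftingProperty_zero_disk_iff (n : ℕ) :
    HasLiftingProperty (0 : 0 ⟶ disk G n) p ↔
      ∀ y : G ⟶ Y.X (n + 1), ∃ x, x ≫ p.f (n + 1) = y := by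
  rw [hasLiftingProperty_zero_iff, (diskHom G n).forall_congr_left]
  refine forall_congr' fun y ↦ (diskHom G n).exists_congr fun l ↦ ?_
  rw [Equiv.eq_symm_apply, diskHom_comp]

theorem hasLiftingProperty_zero_sphere_iff (n : ℕ) :
    HasLiftingProperty (0 : 0 ⟶ sphere G n) p ↔
      ∀ y : G ⟶ Y.cycles n, ∃ x, x ≫ cyclesMap p n = y := by
  rw [hasLiftingProperty_zero_iff, (sphereHom G n).forall_congr_left]
  refine forall_congr' fun y ↦ (sphereHom G n).exists_congr fun l ↦ ?_
  rw [Equiv.eq_symm_apply, sphereHom_comp]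

theorem hasLiftingProperty_sphereToDisk_iff (n : ℕ) :
    HasLiftingProperty (sphereToDisk G n) p ↔
      ∀ y : G ⟶ pullback (Y.toCycles (n + 1) n) (cyclesMap p n), ∃ x, x ≫ matchingMap p n = y := by
  constructor
  · intro _ y
    have sq : CommSq ((sphereHom G n).symm (y ≫ pullback.snd _ _)) (sphereToDisk G n) p
        ((diskHom G n).symm (y ≫ pullback.fst _ _)) := ⟨(sphereHom G n).injective (by
      rw [sphereHom_comp, sphereHom_sphereToDisk_comp, Equiv.apply_symm_apply,
        Equiv.apply_symm_apply, Category.assoc, Category.assoc, pullback.condition])⟩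
    refine ⟨diskHom G n sq.lift, pullback.hom_ext ?_ ?_⟩
    · rw [Category.assoc, matchingMap_fst, ← diskHom_comp, sq.fac_right, Equiv.apply_symm_apply]
    · rw [Category.assoc, matchingMap_snd, ← sphereHom_sphereToDisk_comp, sq.fac_left,
        Equiv.apply_symm_apply]
  · refine fun h ↦ ⟨fun {t b} sq ↦ ?_⟩
    have w : diskHom G n b ≫ Y.toCycles (n + 1) n = sphereHom G n t ≫ cyclesMap p n := by
      rw [← sphereHom_sphereToDisk_comp, ← sphereHom_comp, sq.w]
    obtain ⟨x, hx⟩ := h (pullback.lift _ _ w)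
    refine ⟨⟨⟨(diskHom G n).symm x, (sphereHom G n).injective ?_, (diskHom G n).injective ?_⟩⟩⟩
    · rw [sphereHom_sphereToDisk_comp, Equiv.apply_symm_apply, ← matchingMap_snd p,
        ← Category.assoc, hx]
      exact pullback.lift_snd _ _ _
    · rw [diskHom_comp, Equiv.apply_symm_apply, ← matchingMap_fst, ← Category.assoc, hx]
      exact pullback.lift_fst _ _ _

/-- The generating cofibrations of the projective model structure. -/
def generatingCofibrations : MorphismProperty (ChainComplex C ℕ) :=
  ofHoms (fun _ : Unit ↦ (0 : 0 ⟶ sphere G 0)) ⊔ ofHoms (sphereToDisk G)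

/-- The generating trivial cofibrations of the projective model structure. -/
def generatingTrivialCofibrations : MorphismProperty (ChainComplex C ℕ) :=
  ofHoms fun n ↦ (0 : 0 ⟶ disk G n)

variable {G}

theorem rlp_generatingTrivialCofibrations (hG : IsSeparator G) [Projective G] :
    (generatingTrivialCofibrations G).rlp = chainFibrations C := by
  ext X Y p
  calc (generatingTrivialCofibrations G).rlp p
    _ ↔ ∀ n, HasLiftingProperty (0 : 0 ⟶ disk G n) p :=
      ⟨fun h n ↦ h _ ⟨n⟩, fun h _ _ _ ⟨n⟩ ↦ h n⟩
    _ ↔ ∀ n, Epi (p.f (n + 1)) := forall_congr' fun n ↦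
      (hasLiftingProperty_zero_disk_iff G p n).trans (epi_iff_forall_exists_lift hG _).symm
    _ ↔ chainFibrations C p :=
      ⟨fun h ↦ fun | n + 1, _ => h n, fun h n ↦ h _ n.succ_pos⟩

theorem rlp_generatingCofibrations (hG : IsSeparator G) [Projective G] :
    (generatingCofibrations G).rlp = chainFibrations C ⊓ chainQuasiIsos C := by
  ext X Y p
  rw [chainFibrations_inf_quasiIsos_iff, ← epi_cyclesMap_zero_iff]
  simp only [epi_iff_forall_exists_lift hG, ← hasLiftingProperty_zero_sphere_iff,
    ← hasLiftingProperty_sphereToDisk_iff]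
  refine ⟨fun h ↦ ⟨h _ (.inl ⟨()⟩), fun n ↦ h _ (.inr ⟨n⟩)⟩, ?_⟩
  rintro ⟨h₀, h⟩ _ _ _ (⟨⟨⟩⟩ | ⟨⟨n⟩⟩)
  exacts [h₀, h n]

end Generators

section ModelStructure

open MorphismProperty ZeroObject

variable {C : Type u} [Category.{v} C] [Abelian C] [IsGrothendieckAbelian.{w} C]

theorem hasSmallObjectArgument_of_le_monomorphisms (I : MorphismProperty C) [IsSmall.{w} I]
    (hI : I ≤ monomorphisms C) : HasSmallObjectArgument.{w} I := by
  obtain ⟨κ, hκ', hκ⟩ := HasCardinalLT.exists_regular_cardinal.{w}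
    (Σ f : I.toSet, Subobject f.1.left)
  have : Fact κ.IsRegular := ⟨hκ'⟩
  have : Nonempty κ.ord.ToType := by simpa using hκ'.ne_zero
  have := WellFoundedLT.toOrderBot κ.ord.ToType
  exact ⟨κ, inferInstance, inferInstance, {
    preservesColimit {A B X Y} i hi f hf := by
      let hf' : (monomorphisms C).TransfiniteCompositionOfShape κ.ord.ToType f :=
        { toTransfiniteCompositionOfShape := hf.toTransfiniteCompositionOfShape
          map_mem j hj := by
            have := (hf.attachCells j hj).pushouts_coproducts
            simp only [ofHoms_homFamily] at this
            refine (?_ : _ ≤ monomorphisms C) _ this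
            simp only [pushouts_le_iff, coproducts_le_iff]
            exact hI }
      have (j j' : κ.ord.ToType) (φ : j ⟶ j') : Mono (hf'.F.map φ) := hf'.mem_map φ
      have hA : HasCardinalLT (Subobject A) κ := hκ.of_injective
        (fun S ↦ (⟨⟨Arrow.mk i, hi⟩, S⟩ : Σ f : I.toSet, Subobject f.1.left))
        fun _ _ h ↦ eq_of_heq (Sigma.mk.inj h).2
      exact IsGrothendieckAbelian.preservesColimit_coyoneda_obj_of_mono (Y := hf'.F) (κ := κ) hA }⟩

instance (G : C) : IsSmall.{w} (generatingCofibrations G) :=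
  have h₀ := (isSmall_ofHoms.{w} fun _ : Unit ↦ (0 : 0 ⟶ sphere G 0)).1
  have h₁ := (isSmall_ofHoms.{w} (sphereToDisk G)).1
  ⟨@small_union.{w} _ _ _ h₀ h₁⟩

instance (G : C) : IsSmall.{w} (generatingTrivialCofibrations G) := isSmall_ofHoms.{w} _

variable {G : C} (hG : IsSeparator G) [Projective G]

include hG in
theorem hasFunctorialFactorization_chainCofibrations :
    (chainCofibrations C).HasFunctorialFactorization (chainFibrations C ⊓ chainQuasiIsos C) := by
  rw [← llp_chainFibrations_inf_quasiIsos, ← rlp_generatingCofibrations hG]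
  have : generatingCofibrations G ≤ monomorphisms _ := fun A B i hi ↦ by
    have hi' : chainCofibrations C i := by
      rw [← llp_chainFibrations_inf_quasiIsos, ← rlp_generatingCofibrations hG]
      exact le_llp_rlp _ i hi
    have (n : ℕ) : Mono (i.f n) := (hi' n).1
    exact HomologicalComplex.mono_of_mono_f i this
  have := hasSmallObjectArgument_of_le_monomorphisms.{w} _ this
  infer_instance

variable [EnoughProjectives C]

include hG in
theorem hasFunctorialFactorization_trivialChainCofibrations :
    (chainCofibrations C ⊓ chainQuasiIsos C).HasFunctorialFactorization (chainFibrations C) := by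
  rw [← llp_chainFibrations, ← rlp_generatingTrivialCofibrations hG]
  have : generatingTrivialCofibrations G ≤ monomorphisms _ := by
    rintro _ _ _ ⟨n⟩
    exact (isZero_zero _).mono _
  have := hasSmallObjectArgument_of_le_monomorphisms.{w} _ this
  infer_instance

/-- The projective model structure on non-negatively graded chain complexes. -/
abbrev projectiveModelCategory : ModelCategory (ChainComplex C ℕ) :=
  letI : CategoryWithFibrations (ChainComplex C ℕ) := ⟨chainFibrations C⟩
  letI : CategoryWithCofibrations (ChainComplex C ℕ) := ⟨chainCofibrations C⟩
  letI : CategoryWithWeakEquivalences (ChainComplex C ℕ) := ⟨chainQuasiIsos C⟩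
  haveI : (weakEquivalences (ChainComplex C ℕ)).HasTwoOutOfThreeProperty :=
    inferInstanceAs (chainQuasiIsos C).HasTwoOutOfThreeProperty
  haveI := hasFunctorialFactorization_chainCofibrations.{w} hG
  haveI := hasFunctorialFactorization_trivialChainCofibrations.{w} hG
  haveI : IsWeakFactorizationSystem (cofibrations (ChainComplex C ℕ)) (trivialFibrations _) :=
    { llp := llp_chainFibrations_inf_quasiIsos
      rlp := by
        change (chainCofibrations C).rlp = chainFibrations C ⊓ chainQuasiIsos C
        rw [← llp_chainFibrations_inf_quasiIsos, ← rlp_generatingCofibrations hG, rlp_llp_rlp]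
      hasFactorization := inferInstanceAs
        ((chainCofibrations C).HasFactorization (chainFibrations C ⊓ chainQuasiIsos C)) }
  haveI : IsWeakFactorizationSystem (trivialCofibrations (ChainComplex C ℕ)) (fibrations _) :=
    { llp := llp_chainFibrations
      rlp := by
        change (chainCofibrations C ⊓ chainQuasiIsos C).rlp = chainFibrations C
        rw [← llp_chainFibrations, ← rlp_generatingTrivialCofibrations hG, rlp_llp_rlp]
      hasFactorization := inferInstanceAs
        ((chainCofibrations C ⊓ chainQuasiIsos C).HasFactorization (chainFibrations C)) }
  ModelCategory.mk' _

end ModelStructure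

section Tensor

variable {C : Type u} [Category.{v} C] [Abelian C] [MonoidalCategory C] [MonoidalPreadditive C]
  [SymmetricCategory C]

attribute [local instance] chainMonoidal

open HomologicalComplex (eval)

/-- The inclusion of a summand of the tensor product of chain complexes. -/
def tι (K L : ChainComplex C ℕ) (p q n : ℕ) (h : p + q = n) : K.X p ⊗ L.X q ⟶ (K ⊗ L).X n :=
  HomologicalComplex.ιTensorObj K L p q n h

/-- The map out of a term of the tensor product of chain complexes given by its components. -/
def tdesc {K L : ChainComplex C ℕ} {n : ℕ} {A : C}
    (φ : ∀ p q, p + q = n → (K.X p ⊗ L.X q ⟶ A)) : (K ⊗ L).X n ⟶ A :=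
  HomologicalComplex.mapBifunctorDesc φ

theorem tι_tdesc {K L : ChainComplex C ℕ} {n : ℕ} {A : C}
    (φ : ∀ p q, p + q = n → (K.X p ⊗ L.X q ⟶ A)) (p q : ℕ) (h : p + q = n) :
    tι K L p q n h ≫ tdesc φ = φ p q h :=
  HomologicalComplex.ι_mapBifunctorDesc _ _ _ _

theorem tensor_hom_ext {K L : ChainComplex C ℕ} {n : ℕ} {A : C} {φ ψ : (K ⊗ L).X n ⟶ A}
    (h : ∀ p q (h : p + q = n), tι K L p q n h ≫ φ = tι K L p q n h ≫ ψ) : φ = ψ :=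
  HomologicalComplex.mapBifunctor.hom_ext h

theorem tι_whiskerRight {K K' : ChainComplex C ℕ} (f : K ⟶ K') (L : ChainComplex C ℕ)
    (p q n : ℕ) (h : p + q = n) :
    tι K L p q n h ≫ (f ▷ L).f n = f.f p ▷ L.X q ≫ tι K' L p q n h := by
  have := HomologicalComplex.ι_mapBifunctorMap f (𝟙 L) (curriedTensor C) (.down ℕ) p q n h
  refine this.trans ?_
  change f.f p ▷ L.X q ≫ K'.X p ◁ 𝟙 _ ≫ tι K' L p q n h = _
  rw [whiskerLeft_id, Category.id_comp]

theorem tι_whiskerLeft (K : ChainComplex C ℕ) {L L' : ChainComplex C ℕ} (f : L ⟶ L')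
    (p q n : ℕ) (h : p + q = n) :
    tι K L p q n h ≫ (K ◁ f).f n = K.X p ◁ f.f q ≫ tι K L' p q n h := by
  have := HomologicalComplex.ι_mapBifunctorMap (𝟙 K) f (curriedTensor C) (.down ℕ) p q n h
  refine this.trans ?_
  change 𝟙 _ ▷ L.X q ≫ K.X p ◁ f.f q ≫ tι K L' p q n h = _
  rw [id_whiskerRight, Category.id_comp]

/-- `tι K L p q n h` as a natural transformation in `L`. -/
def tιNat (K : ChainComplex C ℕ) (p q n : ℕ) (h : p + q = n) :
    eval C (.down ℕ) q ⋙ tensorLeft (K.X p) ⟶ tensorLeft K ⋙ eval C (.down ℕ) n where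
  app L := tι K L p q n h
  naturality _ _ f := (tι_whiskerLeft K f p q n h).symm

section Colimits

variable (J : Type*) [Category* J] [∀ X : C, PreservesColimitsOfShape J (tensorLeft X)]

/-- The summands of `K ⊗ L` preserve colimits in `L`, hence so does their direct sum. -/
def isColimitTensorLeftEval [HasColimitsOfShape J C] (K : ChainComplex C ℕ)
    {F : J ⥤ ChainComplex C ℕ} {c : Cocone F} (hc : IsColimit c) (n : ℕ) :
    IsColimit ((tensorLeft K ⋙ eval C (.down ℕ) n).mapCocone c) :=
  let hc' (p q : ℕ) :
      IsColimit ((eval C (.down ℕ) q ⋙ tensorLeft (K.X p)).mapCocone c) :=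
    isColimitOfPreserves _ hc
  let comp (s : Cocone (F ⋙ tensorLeft K ⋙ eval C (.down ℕ) n)) p q h :=
    (Cocone.precompose (Functor.whiskerLeft F (tιNat K p q n h))).obj s
  let desc (s : Cocone (F ⋙ tensorLeft K ⋙ eval C (.down ℕ) n)) : (K ⊗ c.pt).X n ⟶ s.pt :=
    tdesc fun p q h ↦ (hc' p q).desc (comp s p q h)
  have tι_desc s p q h : tι K c.pt p q n h ≫ desc s = (hc' p q).desc (comp s p q h) :=
    tι_tdesc _ p q h
  { desc
    fac s j := tensor_hom_ext fun p q h ↦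
      calc tι K (F.obj j) p q n h ≫ (K ◁ c.ι.app j).f n ≫ desc s
        _ = K.X p ◁ (c.ι.app j).f q ≫ tι K c.pt p q n h ≫ desc s :=
          ((tιNat K p q n h).naturality_assoc (c.ι.app j) (desc s)).symm
        _ = tι K (F.obj j) p q n h ≫ s.ι.app j := by
          rw [tι_desc]
          exact (hc' p q).fac (comp s p q h) j
    uniq s m hm := tensor_hom_ext fun p q h ↦ by
      refine ((hc' p q).uniq (comp s p q h) (tι K c.pt p q n h ≫ m) fun j ↦ ?_).trans
        (tι_desc s p q h).symm
      calc K.X p ◁ (c.ι.app j).f q ≫ tι K c.pt p q n h ≫ m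
        _ = tι K (F.obj j) p q n h ≫ (K ◁ c.ι.app j).f n ≫ m :=
          (tιNat K p q n h).naturality_assoc (c.ι.app j) m
        _ = tι K (F.obj j) p q n h ≫ s.ι.app j := congrArg _ (hm j) }

theorem preservesColimitsOfShape_tensorLeft (K : ChainComplex C ℕ) [HasColimitsOfShape J C] :
    PreservesColimitsOfShape J (tensorLeft K) where
  preservesColimit := ⟨fun hc ↦ ⟨HomologicalComplex.isColimitOfEval _ _ fun n ↦
    isColimitTensorLeftEval J K hc n⟩⟩

end Colimits

theorem nonempty_monoidalClosed [IsGrothendieckAbelian.{v} C]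
    [∀ X : C, PreservesColimitsOfSize.{v, v} (tensorLeft X)] :
    Nonempty (MonoidalClosed (ChainComplex C ℕ)) :=
  have (K : ChainComplex C ℕ) : (tensorLeft K).IsLeftAdjoint :=
    have : PreservesColimits (tensorLeft K) :=
      ⟨fun {J} _ ↦ preservesColimitsOfShape_tensorLeft J K⟩
    isLeftAdjoint_of_preservesColimits_of_isSeparating
      (isSeparator_separator (ChainComplex C ℕ)) _
  ⟨⟨fun K ↦ ⟨_, Adjunction.ofIsLeftAdjoint (tensorLeft K)⟩⟩⟩

/-- Tensoring a homotopy equivalence with a complex. -/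
def homotopyEquivWhiskerRight {K K' : ChainComplex C ℕ} (e : HomotopyEquiv K K')
    (L : ChainComplex C ℕ) : HomotopyEquiv (K ⊗ L) (K' ⊗ L) where
  hom := e.hom ▷ L
  inv := e.inv ▷ L
  homotopyHomInvId := (Homotopy.ofEq (comp_whiskerRight _ _ L).symm).trans
    ((HomologicalComplex.mapBifunctorMapHomotopy₁ e.homotopyHomInvId (𝟙 L) (curriedTensor C)
      (.down ℕ)).trans (Homotopy.ofEq (id_whiskerRight K L)))
  homotopyInvHomId := (Homotopy.ofEq (comp_whiskerRight _ _ L).symm).trans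
    ((HomologicalComplex.mapBifunctorMapHomotopy₁ e.homotopyInvHomId (𝟙 L) (curriedTensor C)
      (.down ℕ)).trans (Homotopy.ofEq (id_whiskerRight K' L)))

end Tensor

section DegreewisePushoutProduct

variable {C : Type u} [Category.{v} C] [Preadditive C] [MonoidalCategory C]

theorem exists_extension_of_retractions {T U V W M : C} {f : T ⟶ U} {g : V ⟶ W} {r : U ⟶ T}
    {r' : W ⟶ V} (hr : f ≫ r = 𝟙 T) (hr' : g ≫ r' = 𝟙 V) (a : U ⊗ V ⟶ M) (b : T ⊗ W ⟶ M)
    (hab : f ▷ V ≫ a = T ◁ g ≫ b) : ∃ l : U ⊗ W ⟶ M, U ◁ g ≫ l = a ∧ f ▷ W ≫ l = b := by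
  refine ⟨U ◁ r' ≫ a + r ▷ W ≫ b - (r ⊗ₘ r') ≫ f ▷ V ≫ a, ?_, ?_⟩
  · simp only [Preadditive.comp_add, Preadditive.comp_sub]
    rw [← whiskerLeft_comp_assoc, hr', tensorHom_def', whisker_exchange_assoc, hab,
      Category.assoc, ← whiskerLeft_comp_assoc, hr']
    simp
  · simp only [Preadditive.comp_add, Preadditive.comp_sub]
    rw [← comp_whiskerRight_assoc, hr, MonoidalCategory.tensorHom_def, hab, Category.assoc,
      ← comp_whiskerRight_assoc, hr, ← whisker_exchange_assoc, hab]
    simp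

variable [MonoidalPreadditive C] {S S' : ShortComplex C} (σ : S.Splitting) (σ' : S'.Splitting)

theorem tensorHom_splitting_comp {M : C} {δ : S.X₂ ⊗ S'.X₂ ⟶ M} (h : S.X₂ ◁ S'.f ≫ δ = 0)
    (h' : S.f ▷ S'.X₂ ≫ δ = 0) : (S.g ⊗ₘ S'.g) ≫ (σ.s ⊗ₘ σ'.s) ≫ δ = δ := by
  have hσ : (S.g ≫ σ.s) ▷ S'.X₂ ≫ δ = δ := by
    simpa [h'] using congrArg (fun φ ↦ φ ▷ S'.X₂ ≫ δ) σ.id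
  have hσ' : S.X₂ ◁ (S'.g ≫ σ'.s) ≫ δ = δ := by
    simpa [h] using congrArg (fun φ ↦ S.X₂ ◁ φ ≫ δ) σ'.id
  rw [tensorHom_comp_tensorHom_assoc, MonoidalCategory.tensorHom_def, Category.assoc, hσ', hσ]

include σ σ' in
/-- The lifting property of the pushout product of `S.f` and `S'.f` against epimorphisms. -/
theorem exists_lift_of_splittings [Projective (S.X₃ ⊗ S'.X₃)] {M N : C} (e : M ⟶ N) [Epi e]
    (a : S.X₂ ⊗ S'.X₁ ⟶ M) (b : S.X₁ ⊗ S'.X₂ ⟶ M) (c : S.X₂ ⊗ S'.X₂ ⟶ N)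
    (hab : S.f ▷ S'.X₁ ≫ a = S.X₁ ◁ S'.f ≫ b) (ha : S.X₂ ◁ S'.f ≫ c = a ≫ e)
    (hb : S.f ▷ S'.X₂ ≫ c = b ≫ e) :
    ∃ l : S.X₂ ⊗ S'.X₂ ⟶ M, S.X₂ ◁ S'.f ≫ l = a ∧ S.f ▷ S'.X₂ ≫ l = b ∧ l ≫ e = c := by
  obtain ⟨l, hla, hlb⟩ := exists_extension_of_retractions σ.f_r σ'.f_r a b hab
  have hδ : (S.g ⊗ₘ S'.g) ≫ (σ.s ⊗ₘ σ'.s) ≫ (c - l ≫ e) = c - l ≫ e :=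
    tensorHom_splitting_comp σ σ' (by simp [ha, reassoc_of% hla]) (by simp [hb, reassoc_of% hlb])
  let lift := Projective.factorThru ((σ.s ⊗ₘ σ'.s) ≫ (c - l ≫ e)) e
  refine ⟨l + (S.g ⊗ₘ S'.g) ≫ lift, ?_, ?_, ?_⟩
  · simp [hla, tensorHom_def'_assoc, ← whiskerLeft_comp_assoc]
  · simp [hlb, tensorHom_def_assoc, ← comp_whiskerRight_assoc]
  · rw [Preadditive.add_comp, Category.assoc, Projective.factorThru_comp, hδ, add_sub_cancel]

end DegreewisePushoutProduct

section PushoutProduct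

variable {C : Type u} [Category.{v} C] [Abelian C] [MonoidalCategory C] [MonoidalPreadditive C]
  [SymmetricCategory C]

attribute [local instance] chainMonoidal

theorem chainCofibrations_pushoutObjObj_ι
    (hP : ∀ P Q : C, Projective P → Projective Q → Projective (P ⊗ Q))
    {T U V W : ChainComplex C ℕ} {f : T ⟶ U} {g : V ⟶ W}
    (sq : (curriedTensor (ChainComplex C ℕ)).PushoutObjObj f g)
    (hf : chainCofibrations C f) (hg : chainCofibrations C g) : chainCofibrations C sq.ι := by
  rw [chainCofibrations_iff]
  intro n M N e (he : Epi e)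
  refine ⟨fun {t b} comm ↦ ?_⟩
  have hsq : IsPushout ((f ▷ V).f n) ((T ◁ g).f n) (sq.inl.f n) (sq.inr.f n) :=
    sq.isPushout.map (HomologicalComplex.eval C (.down ℕ) n)
  have inl_ι : sq.inl.f n ≫ sq.ι.f n = (U ◁ g).f n := congr($(sq.inl_ι).f n)
  have inr_ι : sq.inr.f n ≫ sq.ι.f n = (f ▷ W).f n := congr($(sq.inr_ι).f n)
  have exists_lift (p q : ℕ) (h : p + q = n) := by
    obtain ⟨_, _⟩ := hf p
    obtain ⟨_, _⟩ := hg q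
    have := hP (cokernel (f.f p)) (cokernel (g.f q)) inferInstance inferInstance
    exact exists_lift_of_splittings (cokernelSplitting (f.f p)) (cokernelSplitting (g.f q)) e
      (tι U V p q n h ≫ sq.inl.f n ≫ t) (tι T W p q n h ≫ sq.inr.f n ≫ t) (tι U W p q n h ≫ b)
      (by simp only [← reassoc_of% tι_whiskerRight, ← reassoc_of% tι_whiskerLeft,
        reassoc_of% hsq.w])
      (by simp only [← reassoc_of% tι_whiskerLeft, ← inl_ι, Category.assoc, comm.w])
      (by simp only [← reassoc_of% tι_whiskerRight, ← inr_ι, Category.assoc, comm.w])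
  choose l hl hl' hle using exists_lift
  refine ⟨⟨⟨tdesc l, hsq.hom_ext (tensor_hom_ext fun p q h ↦ ?_) (tensor_hom_ext fun p q h ↦ ?_),
    tensor_hom_ext fun p q h ↦ ?_⟩⟩⟩
  · rw [reassoc_of% inl_ι, reassoc_of% tι_whiskerLeft, tι_tdesc, hl]
  · rw [reassoc_of% inr_ι, reassoc_of% tι_whiskerRight, tι_tdesc, hl']
  · rw [reassoc_of% tι_tdesc, hle]

end PushoutProduct

section ShortExact

variable {C : Type*} [Category* C] [Abelian C] {ι : Type*} {c : ComplexShape ι}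
  {S : ShortComplex (HomologicalComplex C c)}

theorem quasiIso_f_of_acyclic (hS : S.ShortExact) (h : S.X₃.Acyclic) : QuasiIso S.f where
  quasiIsoAt n := by
    have isZero (i : ι) : IsZero (S.X₃.homology i) :=
      (HomologicalComplex.exactAt_iff_isZero_homology _ _).1 (h i)
    have : Mono (HomologicalComplex.homologyMap S.f n) := by
      by_cases! hn : ∃ m, c.Rel m n
      · obtain ⟨m, hmn⟩ := hn
        exact (hS.homology_exact₁ m n hmn).mono_g ((isZero m).eq_of_src _ _)
      · have := hS.mono_f
        exact HomologicalComplex.mono_homologyMap_of_mono_of_not_rel S.f n hn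
    have : Epi (HomologicalComplex.homologyMap S.f n) :=
      (hS.homology_exact₂ n).epi_f ((isZero n).eq_of_tgt _ _)
    rw [quasiIsoAt_iff_isIso_homologyMap]
    exact isIso_of_mono_of_epi _

theorem quasiIso_g_of_acyclic (hS : S.ShortExact) (h : S.X₁.Acyclic) : QuasiIso S.g where
  quasiIsoAt n := by
    have isZero (i : ι) : IsZero (S.X₁.homology i) :=
      (HomologicalComplex.exactAt_iff_isZero_homology _ _).1 (h i)
    have : Mono (HomologicalComplex.homologyMap S.g n) :=
      (hS.homology_exact₂ n).mono_g ((isZero n).eq_of_src _ _)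
    have : Epi (HomologicalComplex.homologyMap S.g n) := by
      by_cases! hn : ∃ m, c.Rel n m
      · obtain ⟨m, hmn⟩ := hn
        exact (hS.homology_exact₃ n m hmn).epi_f ((isZero m).eq_of_tgt _ _)
      · have := hS.epi_g
        exact HomologicalComplex.epi_homologyMap_of_epi_of_not_rel S.g n hn
    rw [quasiIsoAt_iff_isIso_homologyMap]
    exact isIso_of_mono_of_epi _

theorem shortExact_cokernel {A B : C} (f : A ⟶ B) [Mono f] :
    (ShortComplex.mk f (cokernel.π f) (cokernel.condition f)).ShortExact where
  exact := ShortComplex.exact_cokernel f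

theorem shortExact_kernel {A B : C} (f : A ⟶ B) [Epi f] :
    (ShortComplex.mk (kernel.ι f) f (kernel.condition f)).ShortExact where
  exact := ShortComplex.exact_kernel f

theorem quasiIso_inr_of_isPushout {A B A' Z : HomologicalComplex C c} {f : A ⟶ B} {g : A ⟶ A'}
    {i : B ⟶ Z} {j : A' ⟶ Z} (h : IsPushout f g i j) [Mono f] [QuasiIso f] : QuasiIso j := by
  have : Mono j := Abelian.mono_inr_of_isColimit (s := h.cocone) f g h.isColimit
  have acyclic : (cokernel f).Acyclic := (shortExact_cokernel f).acyclic_X₃ ‹_›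
  have := isIso_cokernel_map_of_isPushout h
  exact quasiIso_f_of_acyclic (shortExact_cokernel j)
    fun n ↦ (acyclic n).of_iso (asIso (cokernel.map f j g i h.w))

end ShortExact

section PushoutProductQuasiIso

variable {C : Type u} [Category.{v} C] [Abelian C] [MonoidalCategory C] [MonoidalPreadditive C]
  [SymmetricCategory C]

attribute [local instance] chainMonoidal

open Finset.HasAntidiagonal in
/-- A term of the tensor product of chain complexes as the coproduct of its summands. -/
def isColimitTensorCofan (K L : ChainComplex C ℕ) (n : ℕ) :
    IsColimit (Cofan.mk ((K ⊗ L).X n) fun x : antidiagonal n ↦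
      tι K L x.1.1 x.1.2 n (mem_antidiagonal.1 x.2)) :=
  Cofan.IsColimit.mk _ (fun s ↦ tdesc fun p q h ↦ s.inj ⟨(p, q), mem_antidiagonal.2 h⟩)
    (fun _ _ ↦ tι_tdesc _ _ _ _)
    (fun _ _ hm ↦ tensor_hom_ext fun p q h ↦
      (hm ⟨(p, q), mem_antidiagonal.2 h⟩).trans (Eq.symm (tι_tdesc _ p q h)))

theorem mono_whiskerRight {K K' : ChainComplex C ℕ} (f : K ⟶ K') (L : ChainComplex C ℕ)
    (h : ∀ p q, Mono (f.f p ▷ L.X q)) : Mono (f ▷ L) :=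
  have := Abelian.hasFiniteBiproducts (C := C)
  HomologicalComplex.mono_of_mono_f _ fun n ↦
    MorphismProperty.IsStableUnderColimitsOfShape.condition (W := MorphismProperty.monomorphisms C)
      _ _ _ _ (isColimitTensorCofan K L n) (isColimitTensorCofan K' L n)
      (Discrete.natTrans fun x ↦ f.f x.as.1.1 ▷ L.X x.as.1.2) (fun _ ↦ h _ _) _
      fun _ ↦ tι_whiskerRight f L _ _ _ _

theorem mono_whiskerRight_of_chainCofibrations {K K' : ChainComplex C ℕ} {f : K ⟶ K'}
    (hf : chainCofibrations C f) (L : ChainComplex C ℕ) : Mono (f ▷ L) :=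
  mono_whiskerRight f L fun p q ↦ by
    obtain ⟨_, _⟩ := hf p
    exact ((cokernelSplitting (f.f p)).splitMono_f.map (tensorRight (L.X q))).mono

theorem quasiIso_biprod_inl_whiskerRight (T E : ChainComplex C ℕ) (h : Homotopy (𝟙 E) 0)
    (V : ChainComplex C ℕ) : QuasiIso ((biprod.inl : T ⟶ T ⊞ E) ▷ V) :=
  inferInstanceAs (QuasiIso (homotopyEquivWhiskerRight (homotopyEquivBiprodInl T E h) V).hom)

variable [EnoughProjectives C]

/-- A trivial cofibration is a retract of the inclusion of a direct summand with contractible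
complement. -/
theorem quasiIso_whiskerRight_of_chainCofibrations {T U : ChainComplex C ℕ} {f : T ⟶ U}
    (hf : chainCofibrations C f) (hf' : QuasiIso f) (V : ChainComplex C ℕ) :
    QuasiIso (f ▷ V) := by
  have hllp : (chainFibrations C).llp f := by
    rw [llp_chainFibrations]
    exact ⟨hf, hf'⟩
  have := hllp _ (chainFibrations_biprod_desc_coveringDisksπ f)
  have : QuasiIso ((tensorRight V).map (biprod.inl : T ⟶ T ⊞ coveringDisks U)) :=
    quasiIso_biprod_inl_whiskerRight T _ (disks.homotopyIdZero _) V
  exact quasiIso_of_retractArrow ((RetractArrow.ofLeftLiftingProperty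
    (biprod.inl_desc f (coveringDisksπ U))).map (tensorRight V))

theorem quasiIso_pushoutObjObj_ι_of_left {T U V W : ChainComplex C ℕ} {f : T ⟶ U} {g : V ⟶ W}
    (sq : (curriedTensor (ChainComplex C ℕ)).PushoutObjObj f g)
    (hf : chainCofibrations C f) (hf' : QuasiIso f) : QuasiIso sq.ι := by
  have : Mono (f ▷ V) := mono_whiskerRight_of_chainCofibrations hf V
  have : QuasiIso (f ▷ V) := quasiIso_whiskerRight_of_chainCofibrations hf hf' V
  have : QuasiIso sq.inr := quasiIso_inr_of_isPushout (f := f ▷ V) sq.isPushout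
  have : QuasiIso (sq.inr ≫ sq.ι) := by
    rw [sq.inr_ι]
    exact quasiIso_whiskerRight_of_chainCofibrations hf hf' W
  exact quasiIso_of_comp_left sq.inr sq.ι

attribute [local instance] chainSymmetric in
theorem quasiIso_pushoutObjObj_ι {T U V W : ChainComplex C ℕ} {f : T ⟶ U} {g : V ⟶ W}
    (sq : (curriedTensor (ChainComplex C ℕ)).PushoutObjObj f g) (hf : chainCofibrations C f)
    (hg : chainCofibrations C g) (h : QuasiIso f ∨ QuasiIso g) : QuasiIso sq.ι := by
  rcases h with hf' | hg'
  · exact quasiIso_pushoutObjObj_ι_of_left sq hf hf'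
  · have : QuasiIso (sq.ι ≫ (β_ W U).inv) :=
      quasiIso_pushoutObjObj_ι_of_left sq.flipTensor hg hg'
    exact quasiIso_of_comp_right sq.ι (β_ W U).inv

end PushoutProductQuasiIso

section Flat

variable {C : Type u} [Category.{v} C] [Abelian C]

theorem epi_of_chainFibrations {X Y : ChainComplex C ℕ} {p : X ⟶ Y} (hp : chainFibrations C p)
    [QuasiIso p] : Epi p := by
  obtain ⟨_, _⟩ := (chainFibrations_inf_quasiIsos_iff p).1 ⟨hp, ‹QuasiIso p›⟩
  exact HomologicalComplex.epi_of_epi_f p (epi_f_of_epi_matchingMap p)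

theorem quasiIso_coveringDisksπ_of_acyclic [EnoughProjectives C] {N : ChainComplex C ℕ}
    (hN : N.Acyclic) : QuasiIso (coveringDisksπ N) :=
  ⟨fun n ↦ (quasiIsoAt_iff_exactAt _ _ (disks.acyclic _ n)).2 (hN n)⟩

theorem epi_coveringDisksπ_of_acyclic [EnoughProjectives C] {N : ChainComplex C ℕ}
    (hN : N.Acyclic) : Epi (coveringDisksπ N) := by
  have := quasiIso_coveringDisksπ_of_acyclic hN
  exact epi_of_chainFibrations fun
    | n + 1, _ => inferInstanceAs (Epi ((coveringDisksπ N).f (n + 1)))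

variable [MonoidalCategory C] [MonoidalPreadditive C] [SymmetricCategory C]

attribute [local instance] chainMonoidal

instance (M : ChainComplex C ℕ) : (tensorRight M).PreservesZeroMorphisms where
  map_zero K L := by
    ext n
    exact tensor_hom_ext fun p q h ↦
      (tι_whiskerRight (0 : K ⟶ L) M p q n h).trans (by simp)

/-- Tensoring a contraction of a complex with a complex. -/
def homotopyIdZeroTensor {E : ChainComplex C ℕ} (h : Homotopy (𝟙 E) 0) (M : ChainComplex C ℕ) :
    Homotopy (𝟙 (E ⊗ M)) 0 :=
  (Homotopy.ofEq (id_whiskerRight E M).symm).trans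
    ((HomologicalComplex.mapBifunctorMapHomotopy₁ h (𝟙 M) (curriedTensor C) (.down ℕ)).trans
      (Homotopy.ofEq ((tensorRight M).map_zero E E)))

variable [∀ X : C, PreservesFiniteColimits (tensorLeft X)]

attribute [local instance] chainSymmetric in
theorem preservesFiniteColimits_tensorRight (M : ChainComplex C ℕ) :
    PreservesFiniteColimits (tensorRight M) :=
  ⟨fun J _ _ ↦
    have := preservesColimitsOfShape_tensorLeft J M
    preservesColimitsOfShape_of_natIso (BraidedCategory.tensorLeftIsoTensorRight M)⟩

variable {M : ChainComplex C ℕ} [∀ q, (tensorRight (M.X q)).PreservesMonomorphisms]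

theorem shortExact_map_tensorRight {S : ShortComplex (ChainComplex C ℕ)} (hS : S.ShortExact) :
    (S.map (tensorRight M)).ShortExact := by
  have := preservesFiniteColimits_tensorRight M
  have := hS.epi_g
  have := hS.mono_f
  have : Mono (S.map (tensorRight M)).f :=
    mono_whiskerRight S.f M fun p q ↦
      inferInstanceAs (Mono ((tensorRight (M.X q)).map (S.f.f p)))
  have : Epi (S.map (tensorRight M)).g := inferInstanceAs (Epi ((tensorRight M).map S.g))
  exact { exact := hS.exact.map_of_epi_of_preservesCokernel _ inferInstance inferInstance }

variable [EnoughProjectives C]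

variable (M) in
/-- Dimension shifting along the cover of an acyclic complex by contractible disks. -/
theorem acyclic_tensor {N : ChainComplex C ℕ} (hN : N.Acyclic) : (N ⊗ M).Acyclic := fun n ↦ by
  induction n using Nat.strong_induction_on generalizing N with | _ n ih
  have := epi_coveringDisksπ_of_acyclic hN
  have hS := shortExact_kernel (coveringDisksπ N)
  have acyclic_kernel : (kernel (coveringDisksπ N)).Acyclic :=
    hS.acyclic_X₁ (quasiIso_coveringDisksπ_of_acyclic hN)
  have acyclic_disks : (coveringDisks N ⊗ M).Acyclic :=
    acyclic_of_homotopy_id_zero (homotopyIdZeroTensor (disks.homotopyIdZero _) M)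
  refine (shortExact_map_tensorRight hS).exactAt_X₃ n
    (IsZero.epi ((HomologicalComplex.exactAt_iff_isZero_homology _ _).1 (acyclic_disks n)) _)
    fun j hj ↦ IsZero.mono ((HomologicalComplex.exactAt_iff_isZero_homology _ _).1
      (ih j (Nat.lt_of_succ_le (le_of_eq hj)) acyclic_kernel)) _

theorem quasiIso_whiskerRight_of_epi {X Y : ChainComplex C ℕ} (p : X ⟶ Y) [Epi p]
    [hp : QuasiIso p] : QuasiIso (p ▷ M) :=
  have hS := shortExact_kernel p
  quasiIso_g_of_acyclic (shortExact_map_tensorRight hS) (acyclic_tensor M (hS.acyclic_X₁ hp))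

theorem quasiIso_whiskerRight {K L : ChainComplex C ℕ} (f : K ⟶ L) [QuasiIso f] :
    QuasiIso (f ▷ M) := by
  let i : K ⟶ K ⊞ coveringDisks L := biprod.inl
  let p : K ⊞ coveringDisks L ⟶ L := biprod.desc f (coveringDisksπ L)
  have i_p : i ≫ p = f := biprod.inl_desc _ _
  have : QuasiIso i := quasiIso_biprod_inl K _ (disks.homotopyIdZero _)
  have : QuasiIso (i ≫ p) := by rwa [i_p]
  have : QuasiIso p := quasiIso_of_comp_left i p
  have : Epi p := epi_of_chainFibrations (chainFibrations_biprod_desc_coveringDisksπ f)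
  have : QuasiIso (i ▷ M) := quasiIso_biprod_inl_whiskerRight K _ (disks.homotopyIdZero _) M
  have : QuasiIso (p ▷ M) := quasiIso_whiskerRight_of_epi p
  rw [← i_p, comp_whiskerRight]
  infer_instance

end Flat

section Filtration

theorem iSupIndep_of_forall_disjoint_biSup_lt {ι α : Type*} [LinearOrder ι] [CompleteLattice α]
    [IsModularLattice α] [IsCompactlyGenerated α] {f : ι → α}
    (h : ∀ i, Disjoint (f i) (⨆ j < i, f j)) : iSupIndep f := by
  refine iSupIndep_iff_supIndep.2 fun s ↦ ?_
  induction s using Finset.induction_on_max with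
  | empty => exact Finset.supIndep_empty f
  | insert i s hi hs =>
    exact hs.insert ((h i).mono_right (Finset.sup_le fun j hj ↦ le_iSup₂_of_le j (hi j hj) le_rfl))

variable {R : Type*} [Ring R] {E E' : Type*} [AddCommGroup E] [Module R E] [AddCommGroup E']
  [Module R E']

theorem exists_projective_disjoint_sup_eq {A B : Submodule R E} (h : A ≤ B)
    [Module.Projective R (B.map A.mkQ)] :
    ∃ C : Submodule R E, Module.Projective R C ∧ Disjoint C A ∧ C ⊔ A = B := by
  obtain ⟨σ, hσ⟩ := (A.mkQ.submoduleMap B).exists_rightInverse_of_surjective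
    (LinearMap.range_eq_top.2 (A.mkQ.submoduleMap_surjective B))
  have mkQ_σ (y : B.map A.mkQ) : A.mkQ (σ y) = y := congrArg Subtype.val (LinearMap.congr_fun hσ y)
  have hσ_inj : Function.Injective (B.subtype ∘ₗ σ) :=
    Subtype.val_injective.comp fun y z hyz ↦ Subtype.ext (by rw [← mkQ_σ y, hyz, mkQ_σ z])
  refine ⟨LinearMap.range (B.subtype ∘ₗ σ), .of_equiv (LinearEquiv.ofInjective _ hσ_inj), ?_,
    le_antisymm (sup_le (by rintro _ ⟨y, rfl⟩; exact (σ y).2) h) fun b hb ↦ ?_⟩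
  · rw [Submodule.disjoint_def]
    rintro _ ⟨y, rfl⟩ hy
    have : y = 0 := Subtype.ext ((mkQ_σ y).symm.trans ((Submodule.Quotient.mk_eq_zero A).2 hy))
    rw [this, map_zero]
  · let y : B.map A.mkQ := ⟨A.mkQ b, Submodule.mem_map_of_mem hb⟩
    have hby : b - σ y ∈ A := (Submodule.Quotient.eq A).1 (mkQ_σ y).symm
    exact Submodule.mem_sup.2 ⟨σ y, ⟨y, rfl⟩, b - σ y, hby, add_sub_cancel _ _⟩

variable (F : ℕ → Submodule R E) (F' : ℕ → Submodule R E')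

/-- The `n`-th graded piece `F (n + 1) / F n` of a filtration, as a submodule of `E / F n`. -/
abbrev gradedPiece (n : ℕ) : Submodule R (E ⧸ F n) := (F (n + 1)).map (F n).mkQ

variable {F}

theorem projective_iSup_of_gradedPiece (hF : Monotone F) (hF₀ : F 0 = ⊥)
    [∀ n, Module.Projective R (gradedPiece F n)] : Module.Projective R ↥(⨆ n, F n) := by
  choose C hC hdisj hsup using fun n ↦ exists_projective_disjoint_sup_eq (hF (Nat.le_succ n))
  have C_le (n : ℕ) : C n ≤ F (n + 1) := hsup n ▸ le_sup_left
  have hind : iSupIndep C := iSupIndep_of_forall_disjoint_biSup_lt fun n ↦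
    (hdisj n).mono_right (iSup₂_le fun m hm ↦ (C_le m).trans (hF hm))
  have F_le (n : ℕ) : F n ≤ ⨆ m, C m := by
    induction n with
    | zero => exact hF₀ ▸ bot_le
    | succ n ih => exact hsup n ▸ sup_le (le_iSup C n) ih
  have hrange : LinearMap.range (DFinsupp.lsum ℕ fun n ↦ (C n).subtype) = ⨆ n, F n := by
    rw [← Submodule.iSup_eq_range_dfinsupp_lsum]
    exact le_antisymm (iSup_le fun n ↦ (C_le n).trans (le_iSup F (n + 1))) (iSup_le F_le)
  exact .of_equiv ((LinearEquiv.ofInjective _ hind.dfinsupp_lsum_injective).trans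
    (LinearEquiv.ofEq _ _ hrange))

variable (F) in
/-- The principal part of an element of a filtered module. -/
def symbol (n : ℕ) : F (n + 1) →ₗ[R] gradedPiece F n := (F n).mkQ.submoduleMap (F (n + 1))

theorem symbol_surjective (n : ℕ) : Function.Surjective (symbol F n) :=
  (F n).mkQ.submoduleMap_surjective (F (n + 1))

theorem symbol_eq_symbol_iff {n : ℕ} {x y : F (n + 1)} :
    symbol F n x = symbol F n y ↔ (x - y : E) ∈ F n :=
  Subtype.ext_iff.trans (Submodule.Quotient.eq (F n))

variable {F'}

/-- The map induced on graded pieces by a linear map shifting filtrations. -/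
def gradedMap (f : E →ₗ[R] E') {m n : ℕ} (h : ∀ x ∈ F m, f x ∈ F' n)
    (h' : ∀ x ∈ F (m + 1), f x ∈ F' (n + 1)) : gradedPiece F m →ₗ[R] gradedPiece F' n :=
  ((F m).mapQ (F' n) f h).restrict (by
    rintro _ ⟨x, hx, rfl⟩
    exact ⟨f x, h' x hx, rfl⟩)

theorem gradedMap_symbol (f : E →ₗ[R] E') {m n : ℕ} (h : ∀ x ∈ F m, f x ∈ F' n)
    (h' : ∀ x ∈ F (m + 1), f x ∈ F' (n + 1)) (x : F (m + 1)) :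
    gradedMap f h h' (symbol F m x) = symbol F' n ⟨f x, h' x x.2⟩ := rfl

end Filtration

section ProjectiveOperators

variable {k : Type v} {O : Type u} [Field k] [CommRing O] [Algebra k O]

/-- The commutator with a function, which lowers the order of an operator by one. -/
def bracketWith (a : O) : Module.End k O →ₗ[O] Module.End k O where
  toFun P := P * mulOp k O a - mulOp k O a * P
  map_add' P Q := by noncomm_ring
  map_smul' c P := by
    simp only [← mulOp_mul, RingHom.id_apply, mul_sub, ← mul_assoc, mulOp, ← map_mul, mul_comm]

theorem bracketWith_mem_orderLT (a : O) {n : ℕ} :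
    ∀ P ∈ orderLT k O (n + 1), bracketWith a P ∈ orderLT k O n :=
  fun _ hP ↦ mem_orderLT_succ.1 hP a

/-- Composition with a vector field, which raises the order of an operator by one. -/
def compDerivation (θ : Derivation k O O) : Module.End k O →ₗ[O] Module.End k O where
  toFun P := P * (θ : O →ₗ[k] O)
  map_add' P Q := add_mul P Q _
  map_smul' c P := smul_mul_assoc c P _

theorem compDerivation_mem_orderLT (θ : Derivation k O O) {n : ℕ} :
    ∀ P ∈ orderLT k O n, compDerivation θ P ∈ orderLT k O (n + 1) := by
  cases n with
  | zero =>
    rintro _ rfl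
    exact (map_zero (compDerivation θ)).symm ▸ zero_mem _
  | succ n => exact fun P hP ↦ mul_mem_orderLT n 1 hP (derivation_mem_orderLT θ)

theorem eq_mulOp_of_mem_orderLT_one {P : Module.End k O} (hP : P ∈ orderLT k O 1) :
    P = mulOp k O (P 1) := by
  ext a
  have := LinearMap.congr_fun (sub_eq_zero.1 (hP a)) 1
  simpa [mul_comm] using this

theorem projective_gradedPiece_orderLT_zero :
    Module.Projective O (gradedPiece (orderLT k O) 0) := by
  let i : O →ₗ[O] orderLT k O 1 :=
    LinearMap.toSpanSingleton O _ ⟨mulOp k O 1, mulOp_mem_orderLT 1⟩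
  have i_apply (a : O) : (i a : Module.End k O) = mulOp k O a := by
    ext f
    simp [i]
  refine .of_equiv (LinearEquiv.ofBijective (symbol _ 0 ∘ₗ i) ⟨fun a b hab ↦ ?_, fun y ↦ ?_⟩)
  · have : (i a - i b : Module.End k O) = 0 := symbol_eq_symbol_iff.1 hab
    rw [i_apply, i_apply, sub_eq_zero] at this
    simpa using LinearMap.congr_fun this 1
  · obtain ⟨P, rfl⟩ := symbol_surjective 0 y
    refine ⟨P.1 1, congrArg (symbol _ 0) (Subtype.ext ?_)⟩
    rw [i_apply, ← eq_mulOp_of_mem_orderLT_one P.2]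

/-- The commutator with a function on principal symbols. -/
def gradedBracket (a : O) (n : ℕ) :
    gradedPiece (orderLT k O) (n + 1) →ₗ[O] gradedPiece (orderLT k O) n :=
  gradedMap (bracketWith a) (bracketWith_mem_orderLT a) (bracketWith_mem_orderLT a)

/-- Multiplication of principal symbols by a vector field. -/
def gradedCompDerivation (θ : Derivation k O O) (n : ℕ) :
    gradedPiece (orderLT k O) n →ₗ[O] gradedPiece (orderLT k O) (n + 1) :=
  gradedMap (compDerivation θ) (compDerivation_mem_orderLT θ) (compDerivation_mem_orderLT θ)

theorem sum_gradedCompDerivation_gradedBracket {S : Finset O} {p : O → Derivation k O O}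
    (h : ∀ a : O, KaehlerDifferential.D k O a = ∑ x ∈ S, p x a • KaehlerDifferential.D k O x)
    {n : ℕ} (y : gradedPiece (orderLT k O) (n + 1)) :
    ∑ x ∈ S, gradedCompDerivation (p x) n (gradedBracket x n y) = (n + 1) • y := by
  obtain ⟨P, rfl⟩ := symbol_surjective (n + 1) y
  simp only [gradedBracket, gradedCompDerivation, gradedMap_symbol, ← map_sum, ← map_nsmul,
    symbol_eq_symbol_iff]
  simpa [bracketWith, compDerivation] using euler_orderLT h (n + 1) P P.2

variable [CharZero k]

theorem projective_gradedPiece_orderLT_succ {S : Finset O} {p : O → Derivation k O O}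
    (h : ∀ a : O, KaehlerDifferential.D k O a = ∑ x ∈ S, p x a • KaehlerDifferential.D k O x)
    (n : ℕ) [Module.Projective O (gradedPiece (orderLT k O) n)] :
    Module.Projective O (gradedPiece (orderLT k O) (n + 1)) := by
  have : Module.Projective O (S → gradedPiece (orderLT k O) n) :=
    .of_equiv DFinsupp.linearEquivFunOnFintype
  obtain ⟨u, hu⟩ : IsUnit ((n + 1 : ℕ) : O) := by
    simpa using (IsUnit.mk0 ((n + 1 : ℕ) : k) (Nat.cast_ne_zero.2 n.succ_ne_zero)).map
      (algebraMap k O)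
  refine .of_split (LinearMap.pi fun x : S ↦ gradedBracket x.1 n)
    ((↑u⁻¹ : O) • ∑ x : S, gradedCompDerivation (p x) n ∘ₗ LinearMap.proj x)
    (LinearMap.ext fun y ↦ ?_)
  have euler := sum_gradedCompDerivation_gradedBracket h y
  rw [← Finset.sum_coe_sort S, ← Nat.cast_smul_eq_nsmul O, ← hu] at euler
  simp only [LinearMap.comp_apply, LinearMap.smul_apply, LinearMap.sum_apply, LinearMap.pi_apply,
    LinearMap.proj_apply, euler, smul_smul, Units.inv_mul, one_smul, LinearMap.id_apply]

variable (k O) [Algebra.Smooth k O]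

theorem projective_gradedPiece_orderLT (n : ℕ) :
    Module.Projective O (gradedPiece (orderLT k O) n) := by
  obtain ⟨S, p, h⟩ := exists_coords k O
  induction n with
  | zero => exact projective_gradedPiece_orderLT_zero
  | succ n ih => exact projective_gradedPiece_orderLT_succ h n

theorem projective_toO_diffOp :
    Module.Projective O ((toO k O).obj (ModuleCat.of (DiffOp k O) (DiffOp k O))) := by
  let e : ↥(⨆ n, orderLT k O n) ≃ₗ[O]
      (toO k O).obj (ModuleCat.of (DiffOp k O) (DiffOp k O)) :=
    { toFun P := (⟨P, (Submodule.mem_iSup_of_directed _ orderLT_mono.directed_le).1 P.2⟩ :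
        DiffOp k O)
      invFun P := ⟨Subtype.val (p := (· ∈ DiffOp k O)) P,
        (Submodule.mem_iSup_of_directed _ orderLT_mono.directed_le).2 (Subtype.property P)⟩
      map_add' _ _ := rfl
      map_smul' a P := Subtype.ext (mulOp_mul a P.1).symm }
  have := projective_gradedPiece_orderLT k O
  have := projective_iSup_of_gradedPiece (F := orderLT k O) orderLT_mono rfl
  exact .of_equiv e

end ProjectiveOperators

section RestrictionOfScalars

variable {R S : Type u} [Ring R] [Ring S] (f : R →+* S)
  [Module.Projective R ((ModuleCat.restrictScalars f).obj (ModuleCat.of S S))]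

theorem preservesEpimorphisms_coextendScalars :
    (ModuleCat.coextendScalars.{u, u, u} f).PreservesEpimorphisms where
  preserves {M N} g hg := by
    rw [ModuleCat.epi_iff_surjective] at hg ⊢
    intro ψ
    obtain ⟨φ, hφ⟩ := Module.projective_lifting_property g.hom
      (show (ModuleCat.restrictScalars f).obj (ModuleCat.of S S) →ₗ[R] N from ψ) hg
    exact ⟨φ, hφ⟩

theorem projective_restrictScalars_obj (P : ModuleCat.{u} S) [Projective P] :
    Projective ((ModuleCat.restrictScalars f).obj P) :=
  have := preservesEpimorphisms_coextendScalars f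
  (ModuleCat.restrictCoextendScalarsAdj f).map_projective P inferInstance

end RestrictionOfScalars

namespace FlatConnection

variable {k : Type v} {O : Type u} [Field k] [CommRing O] [Algebra k O]
  {V W : Type*} [AddCommGroup V] [Module O V] [AddCommGroup W] [Module O W]

/-- The action of a vector field on linear maps: `(θ g) v = θ (g v) - g (θ v)`. -/
def ihomNabla (c : FlatConnection k O V) (d : FlatConnection k O W) (θ : Derivation k O O) :
    (V →ₗ[O] W) →+ (V →ₗ[O] W) where
  toFun g :=
    { toFun v := d.nabla θ (g v) - g (c.nabla θ v)
      map_add' v w := by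
        simp only [map_add]
        abel
      map_smul' a v := by
        simp only [map_smul, leibniz, map_add, RingHom.id_apply, smul_sub]
        abel }
  map_zero' := by
    ext v
    simp
  map_add' g g' := by
    ext v
    simp only [LinearMap.coe_mk, AddHom.coe_mk, LinearMap.add_apply, map_add]
    abel

theorem ihomNabla_apply (c : FlatConnection k O V) (d : FlatConnection k O W)
    (θ : Derivation k O O) (g : V →ₗ[O] W) (v : V) :
    c.ihomNabla d θ g v = d.nabla θ (g v) - g (c.nabla θ v) := rfl

/-- The flat connection on the linear maps between two modules with flat connections. -/
def ihom (c : FlatConnection k O V) (d : FlatConnection k O W) :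
    FlatConnection k O (V →ₗ[O] W) where
  nabla := c.ihomNabla d
  nabla_add θ η g := by
    ext v
    simp only [ihomNabla_apply, LinearMap.add_apply, nabla_add, map_add]
    abel
  nabla_smul a θ g := by
    ext v
    simp only [ihomNabla_apply, LinearMap.smul_apply, nabla_smul, map_smul, smul_sub]
  leibniz θ a g := by
    ext v
    simp only [ihomNabla_apply, LinearMap.smul_apply, LinearMap.add_apply, leibniz, smul_sub]
    abel
  nabla_lie θ η g := by
    ext v
    simp only [ihomNabla_apply, LinearMap.sub_apply, nabla_lie, map_sub]
    abel

end FlatConnection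

section InternalHom

open TensorProduct

variable {k : Type v} {O : Type u} [Field k] [CommRing O] [Algebra k O]
  [CharZero k] [Algebra.Smooth k O]

/-- The carrier of the internal hom of `D`-modules: the linear maps over `O`. -/
def IhomCarrier (M N : DModCat k O) : Type u := (toO k O).obj M →ₗ[O] (toO k O).obj N

instance (M N : DModCat k O) : AddCommGroup (IhomCarrier M N) :=
  inferInstanceAs (AddCommGroup ((toO k O).obj M →ₗ[O] (toO k O).obj N))

/-- The action of `D` on linear maps over `O`: functions act by scalar multiplication and vector
fields act through the connection. -/
@[reducible]
def ihomModule (M N : DModCat k O) :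
    Module (DiffOp k O) ((toO k O).obj M →ₗ[O] (toO k O).obj N) :=
  Module.compHom _ ((conn M).ihom (conn N)).act

instance (M N : DModCat k O) : Module (DiffOp k O) (IhomCarrier M N) := ihomModule M N

/-- The `D`-module of `O`-linear maps between two `D`-modules. -/
def ihomDMod (M N : DModCat k O) : DModCat k O := ModuleCat.of _ (IhomCarrier M N)

/-- The `O`-module underlying the internal hom of `D`-modules is the module of `O`-linear maps. -/
def ihomEquiv (M N : DModCat k O) :
    ((toO k O).obj M →ₗ[O] (toO k O).obj N) ≃ₗ[O] (toO k O).obj (ihomDMod M N) where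
  toFun x := x
  invFun x := x
  map_add' _ _ := rfl
  map_smul' a x := (((conn M).ihom (conn N)).act_ofFun a x).symm

theorem ihomEquiv_nabla (M N : DModCat k O) (θ : Derivation k O O)
    (g : (toO k O).obj M →ₗ[O] (toO k O).obj N) :
    (conn (ihomDMod M N)).nabla θ (ihomEquiv M N g) =
      ihomEquiv M N (((conn M).ihom (conn N)).nabla θ g) :=
  ((conn M).ihom (conn N)).act_ofDer θ g

/-- Postcomposition with a morphism of `D`-modules. -/
def ihomMap (Q : DModCat k O) {M N : DModCat k O} (e : M ⟶ N) : ihomDMod Q M ⟶ ihomDMod Q N :=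
  homMk (ModuleCat.ofHom ((ihomEquiv Q N).toLinearMap ∘ₗ
    LinearMap.compRight O ((toO k O).map e).hom ∘ₗ (ihomEquiv Q M).symm.toLinearMap) :) (by
    intro θ g
    obtain ⟨g, rfl⟩ := (ihomEquiv Q M).surjective g
    rw [ihomEquiv_nabla]
    refine Eq.trans ?_ (ihomEquiv_nabla Q N θ (((toO k O).map e).hom ∘ₗ g)).symm
    refine congrArg (ihomEquiv Q N) (LinearMap.ext fun q ↦ ?_)
    change (toO k O).map e ((conn M).nabla θ (g q) - g ((conn Q).nabla θ q)) =
      (conn N).nabla θ ((toO k O).map e (g q)) - (toO k O).map e (g ((conn Q).nabla θ q))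
    rw [map_sub, conn_map])

/-- The functor `Hom_O(Q, -)` on `D`-modules. -/
def ihomFunctor (Q : DModCat k O) : DModCat k O ⥤ DModCat k O where
  obj := ihomDMod Q
  map := ihomMap Q
  map_id _ := rfl
  map_comp _ _ := rfl

/-- Currying of morphisms of `D`-modules. -/
def curryDMod {P Q N : DModCat k O} (b : P ⊗ Q ⟶ N) : P ⟶ ihomDMod Q N :=
  homMk (ModuleCat.ofHom ((ihomEquiv Q N).toLinearMap ∘ₗ
    TensorProduct.curry ((muIso P Q).hom ≫ (toO k O).map b).hom) :) (by
    intro θ p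
    refine Eq.trans ?_ (ihomEquiv_nabla Q N θ _).symm
    refine congrArg (ihomEquiv Q N) (LinearMap.ext fun q ↦ ?_)
    change (toO k O).map b ((muIso P Q).hom ((conn P).nabla θ p ⊗ₜ[O] q)) =
      (conn N).nabla θ ((toO k O).map b ((muIso P Q).hom (p ⊗ₜ[O] q))) -
        (toO k O).map b ((muIso P Q).hom (p ⊗ₜ[O] (conn Q).nabla θ q))
    rw [← conn_map, eq_sub_iff_add_eq, ← map_add]
    exact congrArg ((toO k O).map b) (muIso_tmul_nabla P Q θ p q).symm)

/-- Uncurrying of morphisms of `D`-modules. -/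
def uncurryDMod {P Q N : DModCat k O} (l : P ⟶ ihomDMod Q N) : P ⊗ Q ⟶ N :=
  homMk ((muIso P Q).inv ≫ (ModuleCat.ofHom (TensorProduct.lift
    ((ihomEquiv Q N).symm.toLinearMap ∘ₗ ((toO k O).map l).hom)) :)) (by
    intro θ x
    induction x using muIso_induction with
    | h p q =>
      refine (congrArg _ (muIso_tmul_nabla P Q θ p q)).trans ?_
      rw [map_add]
      change (ihomEquiv Q N).symm ((toO k O).map l ((conn P).nabla θ p)) q +
        (ihomEquiv Q N).symm ((toO k O).map l p) ((conn Q).nabla θ q) =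
        (conn N).nabla θ ((ihomEquiv Q N).symm ((toO k O).map l p) q)
      obtain ⟨g, hg⟩ := (ihomEquiv Q N).surjective ((toO k O).map l p)
      rw [conn_map, ← hg, ihomEquiv_nabla, LinearEquiv.symm_apply_apply,
        LinearEquiv.symm_apply_apply]
      exact sub_add_cancel _ _
    | hadd x y hx hy => simp only [map_add, hx, hy])

theorem tensor_hom_ext_tmul {P Q N : DModCat k O} {b b' : P ⊗ Q ⟶ N}
    (h : ∀ p q, (toO k O).map b ((muIso P Q).hom (p ⊗ₜ[O] q)) =
      (toO k O).map b' ((muIso P Q).hom (p ⊗ₜ[O] q))) : b = b' := by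
  refine (toO k O).map_injective ?_
  ext x
  induction x using muIso_induction with
  | h p q => exact h p q
  | hadd x y hx hy => simp only [map_add, hx, hy]

/-- The tensor-hom adjunction for `D`-modules. -/
def tensorIhomAdjunction (Q : DModCat k O) : tensorRight Q ⊣ ihomFunctor Q :=
  Adjunction.mkOfHomEquiv
    { homEquiv _ _ :=
        { toFun := curryDMod
          invFun := uncurryDMod
          left_inv _ := tensor_hom_ext_tmul fun _ _ ↦ rfl
          right_inv _ := rfl }
      homEquiv_naturality_left_symm _ _ := tensor_hom_ext_tmul fun _ _ ↦ rfl
      homEquiv_naturality_right _ _ := rfl }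

theorem preservesColimits_tensorLeft (M : DModCat k O) :
    PreservesColimitsOfSize.{u, u} (tensorLeft M) :=
  have : PreservesColimitsOfSize.{u, u} (tensorRight M) :=
    (tensorIhomAdjunction M).leftAdjoint_preservesColimits
  preservesColimits_of_natIso (BraidedCategory.tensorLeftIsoTensorRight M).symm

theorem projective_toO_obj (P : DModCat k O) [Projective P] :
    Module.Projective O ((toO k O).obj P) :=
  have := projective_toO_diffOp k O
  (IsProjective.iff_projective _).2 (projective_restrictScalars_obj (ofFun k O) P)

theorem preservesMonomorphisms_tensorRight (P : DModCat k O) [Projective P] :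
    (tensorRight P).PreservesMonomorphisms := by
  have := projective_toO_obj P
  have : (tensorRight P ⋙ toO k O).PreservesMonomorphisms :=
    .of_iso (Functor.Monoidal.commTensorRight (toO k O) P)
  exact ⟨fun f _ ↦ (toO k O).mono_of_mono_map ((tensorRight P ⋙ toO k O).map_mono f)⟩

theorem preservesEpimorphisms_ihomFunctor (Q : DModCat k O) [Projective Q] :
    (ihomFunctor Q).PreservesEpimorphisms where
  preserves {M N} e _ := by
    have := projective_toO_obj Q
    rw [ModuleCat.epi_iff_surjective]
    intro ψ
    obtain ⟨φ, hφ⟩ := Module.projective_lifting_property ((toO k O).map e).hom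
      ((ihomEquiv Q N).symm ψ) ((ModuleCat.epi_iff_surjective _).1 inferInstance)
    exact ⟨ihomEquiv Q M φ, congrArg (ihomEquiv Q N) hφ⟩

theorem projective_tensor (P Q : DModCat k O) [Projective P] [Projective Q] :
    Projective (P ⊗ Q) :=
  have := preservesEpimorphisms_ihomFunctor Q
  (tensorIhomAdjunction Q).map_projective P inferInstance

end InternalHom

section Monoidal

variable {C : Type u} [Category.{v} C] [Abelian C]

theorem projective_X_of_chainCofibrations_initial {M : ChainComplex C ℕ}
    (hM : chainCofibrations C (initial.to M)) (n : ℕ) : Projective (M.X n) := by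
  have h₀ : (initial.to M).f n = 0 := by
    rw [initialIsInitial.hom_ext (initial.to M) 0, HomologicalComplex.zero_f]
  exact (hM n).2.of_iso (cokernelIsoOfEq h₀ ≪≫ cokernelZeroIsoTarget)

variable [MonoidalCategory C] [MonoidalPreadditive C] [SymmetricCategory C]
  [EnoughProjectives C]

attribute [local instance] chainMonoidal chainSymmetric

theorem quasiIso_whiskerRight_of_chainCofibrations_initial
    [∀ X : C, PreservesFiniteColimits (tensorLeft X)]
    (hflat : ∀ P : C, Projective P → (tensorRight P).PreservesMonomorphisms)
    {M : ChainComplex C ℕ} (hM : chainCofibrations C (initial.to M)) {K L : ChainComplex C ℕ}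
    (f : K ⟶ L) (_ : QuasiIso f) : QuasiIso (f ▷ M) :=
  have (q : ℕ) := hflat (M.X q) (projective_X_of_chainCofibrations_initial hM q)
  quasiIso_whiskerRight f

theorem isSymmetricMonoidalModelCategory_projectiveModelCategory
    [IsGrothendieckAbelian.{v} C] [∀ X : C, PreservesColimitsOfSize.{v, v} (tensorLeft X)]
    {G : C} (hG : IsSeparator G) [Projective G]
    (htensor : ∀ P Q : C, Projective P → Projective Q → Projective (P ⊗ Q))
    (hflat : ∀ P : C, Projective P → (tensorRight P).PreservesMonomorphisms) :
    letI := projectiveModelCategory.{v} hG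
    IsSymmetricMonoidalModelCategory (ChainComplex C ℕ) :=
  letI := projectiveModelCategory.{v} hG
  { hasLimits := inferInstance
    hasColimits := inferInstance
    functorialFactorization_cof_trivFib := hasFunctorialFactorization_chainCofibrations.{v} hG
    functorialFactorization_trivCof_fib :=
      hasFunctorialFactorization_trivialChainCofibrations.{v} hG
    closed := nonempty_monoidalClosed
    pushoutProduct_cofibration _ _ hf hg := (cofibration_iff _).2 <|
      chainCofibrations_pushoutObjObj_ι htensor (.ofHasPushout ..)
        ((cofibration_iff _).1 hf) ((cofibration_iff _).1 hg)
    pushoutProduct_weakEquivalence _ _ hf hg h := (weakEquivalence_iff _).2 <|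
      quasiIso_pushoutObjObj_ι (.ofHasPushout ..)
        ((cofibration_iff _).1 hf) ((cofibration_iff _).1 hg)
        (h.imp (weakEquivalence_iff _).1 (weakEquivalence_iff _).1)
    unit_weakEquivalence q _ _ hq _ hX := (weakEquivalence_iff _).2 <|
      quasiIso_whiskerRight_of_chainCofibrations_initial hflat hX.mem q
        ((weakEquivalence_iff _).1 hq) }

end Monoidal

section DModules

variable (k : Type v) (O : Type u) [Field k] [CommRing O] [Algebra k O]

/-- The free `D`-module of rank one, in the universe of `O`. -/
abbrev freeDMod : DModCat k O :=
  ModuleCat.of (DiffOp k O) (Shrink.{u} (DiffOp k O))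

instance : Projective (freeDMod k O) :=
  ModuleCat.projective_of_free ((Module.Basis.singleton Unit (DiffOp k O)).map
    (Shrink.linearEquiv (DiffOp k O) (DiffOp k O)).symm)

theorem isSeparator_freeDMod : IsSeparator (freeDMod k O) :=
  ModuleCat.isSeparator.{u} (DiffOp k O)

end DModules

end DMod

end

theorem mainTheorem1_general (k : Type v) (O : Type u) [Field k] [CharZero k]
    [CommRing O] [Algebra k O] [Algebra.Smooth k O] :
    ∃ _ : ModelCategory (DGDM k O),
      weakEquivalences (DGDM k O) = quasiIsos k O ∧
      fibrations (DGDM k O) = projFibrations k O ∧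
      cofibrations (DGDM k O) = projCofibrations k O ∧
      IsSymmetricMonoidalModelCategory (DGDM k O) ∧
      ∀ (M : DGDM k O), IsCofibrant M →
        ∀ {K L : DGDM k O} (f : K ⟶ L), QuasiIso f → QuasiIso (f ▷ M) := by
  have hG := isSeparator_freeDMod k O
  have := preservesColimits_tensorLeft (k := k) (O := O)
  have flat (P : DModCat k O) (_ : Projective P) := preservesMonomorphisms_tensorRight P
  let _ := projectiveModelCategory.{u} hG
  exact ⟨inferInstance, rfl, rfl, rfl,
    isSymmetricMonoidalModelCategory_projectiveModelCategory hG
      (fun P Q _ _ ↦ projective_tensor P Q) flat,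
    fun _ hM ↦ quasiIso_whiskerRight_of_chainCofibrations_initial flat hM.mem⟩

theorem mainTheorem1 (k : Type v) (O : Type u) [Field k] [IsAlgClosed k] [CharZero k]
    [CommRing O] [Algebra k O] [Algebra.Smooth k O] :
    ∃ _ : ModelCategory (DGDM k O),
      weakEquivalences (DGDM k O) = quasiIsos k O ∧
      fibrations (DGDM k O) = projFibrations k O ∧
      cofibrations (DGDM k O) = projCofibrations k O ∧
      IsSymmetricMonoidalModelCategory (DGDM k O) ∧
      ∀ (M : DGDM k O), IsCofibrant M →
        ∀ {K L : DGDM k O} (f : K ⟶ L), QuasiIso f → QuasiIso (f ▷ M) :=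
  mainTheorem1_general k O
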